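/- Let $\mathbb K\in\{\mathbb R,\mathbb C\}$, and let $\mathbb N^{<\mathbb N}$ be the set of all finite sequences of natural numbers, including the empty one. Write $\eta\subset\nu$ if $\eta$ is an initial segment of $\nu$, and call $T\subset\mathbb N^{<\mathbb N}$ a tree if $\eta\subset\nu\in T$ implies $\eta\in T$. For vectors $x_\eta$ of a Banach space, $\sum_{\eta}x_\eta$ denotes the limit of $\sum_{\eta\in T}x_\eta$ over the finite trees $T$ directed by inclusion; a basis $\{e_\eta:\eta\in\mathbb N^{<\mathbb N}\}$ and its expansions are understood with respect to this summation. A sum $\sum_{\eta\in S} x_\eta$ over a subset $S$ is obtained by putting $x_\eta=0$ for $\eta\notin S$. *Generalized $\ell^2$-sum.* Let $X$ and $Y_k$ $(k\in\mathbb N)$ be Banach spaces, and for every $k$ let $\|\cdot\|_{X\oplus Y_k}$ be a norm on $X\oplus Y_k$ which extends the norms of $X$ and of $Y_k$ and satisfies $\|x+y\|_{X\oplus Y_k}\ge\|x\|_X$ for $x\in X$, $y\in Y_k$. Let $\Lambda$ be the set of all functionals $x^*+\sum_k\alpha_k y_k^*$ with $x^*\in X^*$, $y_k^*\in Y_k^*$,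 $\|x^*+y_k^*\|_{(X\oplus Y_k)^*}\le 1$ for every $k$, $0\le\alpha_k\le 1$ and $\sum_k\alpha_k^2\le 1$. Then $\Sigma(X\oplus Y_k)$ is the space of all formal sums $z=x+y_1+y_2+\cdots$ with $x\in X$, $y_k\in Y_k$, $\sum_k\|y_k\|_{Y_k}^2<\infty$, with the norm $\|z\|_\Sigma=\sup\{|z^*(z)|:z^*\in\Lambda\}$. **Proposition.** Let $(F,\|\cdot\|_F)$ be a Banach space over $\mathbb K$ with a monotone basis $\{f_1,f_2,\dots\}$ and let $P_n$ be the associated partial sum operators (so $\|P_n\|\le1$ for all $n$). Then there is a Banach space $(E,\|\cdot\|)$ over $\mathbb K$ with a basis $\{e_\eta:\eta\in\mathbb N^{<\mathbb N}\}$ such that the following hold. (a) For all $(n_1,\dots,n_l)\in\mathbb N^{<\mathbb N}$ and all scalars $r_0,\dots,r_l$, $$\Big\|\sum_{i=0}^l r_i e_{(n_1,\dots,n_i)}\Big\|=\Big\|\sum_{i=0}^l r_i f_{i+1}\Big\|_F .$$ (b) For every $\nu=(n_1,\dots,n_l)\in\mathbb N^{<\mathbb N}$ we have $E_\nu=\Sigma(E_{\nu,k})$,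 where $E_\nu=\overline{\mathrm{span}}\{e_\eta:\eta\subset\nu\text{ or }\nu\subset\eta\}$ and $E_{\nu,k}=E_{(n_1,\dots,n_l,k)}$. That is, put $X=\mathrm{span}\{e_\eta:\eta\subset\nu\}$ and $Y_k=\overline{\mathrm{span}}\{e_\eta:(n_1,\dots,n_l,k)\subset\eta\}$. Then $E_{\nu,k}=X\oplus Y_k$, the norm of $E$ on these spaces satisfies the requirements in the definition of the generalized $\ell^2$-sum, and the map sending the formal sum $x+y_1+y_2+\cdots$ to its sum in $E$ is a linear isometry of $\Sigma(X\oplus Y_k)$ onto $E_\nu$. (c) For every tree $T$, the projection $P_T:\sum_{\eta}r_\eta e_\eta\mapsto\sum_{\eta\in T}r_\eta e_\eta$ is well defined on $E$ and satisfies $\|P_T\|\le1$. (d) Let $l\in\mathbb N\cup\{0\}$ and let $c_l>0$ be a constant such that $$\|f\|_F\ge\|P_{l+1}f\|_F+c_l\,\|f-P_{l+1}f\|_F\qquad(f\in F).$$ Then for every $\nu\in\mathbb N^l$ and every $\sum_{\eta}r_\eta e_\eta\in E_\nu$, $$\Big\|\sum_{\eta}r_\eta e_\eta\Big\|\ge\Big\|\sum_{\eta\subset\nu}r_\eta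 e_\eta\Big\|+c_l\Big\|\sum_{\eta\supsetneq\nu}r_\eta e_\eta\Big\| .$$ -/

import Mathlib

open Filter Topology

universe u v

/-! ### Trees of finite sequences -/

/-- A set of finite sequences is a tree if it is closed under initial segments
(`η <+: ν` means that `η` is an initial segment of `ν`). -/
def IsSeqTree (T : Set (List ℕ)) : Prop :=
  ∀ ⦃η ν : List ℕ⦄, η <+: ν → ν ∈ T → η ∈ T

/-- Summation over `List ℕ` along the finite trees directed by inclusion. -/
def finiteTrees : SummationFilter (List ℕ) where
  filter := (atTop : Filter {T : Finset (List ℕ) // IsSeqTree (T : Set (List ℕ))}).map Subtype.val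

/-- The finite trees form a non-empty directed set, so limits along them are unique. -/
instance finiteTrees_neBot : finiteTrees.NeBot := by
  classical
  have : Nonempty {T : Finset (List ℕ) // IsSeqTree (T : Set (List ℕ))} :=
    ⟨⟨∅, fun _ _ _ h => by simp at h⟩⟩
  have : IsDirectedOrder {T : Finset (List ℕ) // IsSeqTree (T : Set (List ℕ))} := by
    refine ⟨fun S T => ⟨⟨S.1 ∪ T.1, ?_⟩, ?_, ?_⟩⟩
    · intro η ν h hν
      rw [Finset.mem_coe, Finset.mem_union] at hν ⊢
      exact hν.imp (fun h' => S.2 h h') (fun h' => T.2 h h')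
    · exact Subtype.coe_le_coe.mp Finset.subset_union_left
    · exact Subtype.coe_le_coe.mp Finset.subset_union_right
  exact ⟨(atTop_neBot).map _⟩

/-! ### The generalized `ℓ²`-sum -/

section GenSum

variable {𝕜 : Type*} [RCLike 𝕜]
  {X : Type*} [NormedAddCommGroup X] [NormedSpace 𝕜 X]
  {Y : ℕ → Type*} [∀ k, NormedAddCommGroup (Y k)] [∀ k, NormedSpace 𝕜 (Y k)]

/-- The standing requirements on the norms of the spaces `X ⊕ Y k`: the norm of `X ⊕ Y k` extends
those of `X` and of `Y k`, and it is monotone. (Such a seminorm is automatically a norm.) -/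
structure IsMonotoneSumNorm (N : ∀ k, Seminorm 𝕜 (X × Y k)) : Prop where
  left : ∀ k (x : X), N k (x, 0) = ‖x‖
  right : ∀ k (y : Y k), N k (0, y) = ‖y‖
  mono : ∀ k (x : X) (y : Y k), ‖x‖ ≤ N k (x, y)

variable (X Y) in
/-- The underlying vector space of `Σ(X ⊕ Y k)`: all formal sums `x + y 0 + y 1 + ⋯`
with `∑ ‖y k‖ ^ 2 < ∞`. -/
abbrev GenSum : Type _ := X × lp Y 2

/-- The set `Λ(X ⊕ Y k)` of functionals `x' + ∑ α k • y' k` on `Σ(X ⊕ Y k)`, where the dual norm of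
`x' + y' k` with respect to `X ⊕ Y k` is at most `1`, `0 ≤ α k ≤ 1` and `∑ α k ^ 2 ≤ 1`. The series
below converges absolutely, since `|y' k y| ≤ ‖y‖` when `N` is as in `IsMonotoneSumNorm`. -/
def genLambda (N : ∀ k, Seminorm 𝕜 (X × Y k)) : Set (GenSum X Y → 𝕜) :=
  {φ | ∃ (x' : StrongDual 𝕜 X) (y' : ∀ k, StrongDual 𝕜 (Y k)) (α : ℕ → ℝ),
    (∀ k (x : X) (y : Y k), ‖x' x + y' k y‖ ≤ N k (x, y)) ∧
    (∀ k, 0 ≤ α k ∧ α k ≤ 1) ∧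
    (Summable fun k => α k ^ 2) ∧ ∑' k, α k ^ 2 ≤ 1 ∧
    ∀ z : GenSum X Y, φ z = x' z.1 + ∑' k, (α k : 𝕜) * y' k (z.2 k)}

/-- The norm of `Σ(X ⊕ Y k)`: the supremum of `|φ z|` over `φ ∈ Λ(X ⊕ Y k)`. -/
noncomputable def genNorm (N : ∀ k, Seminorm 𝕜 (X × Y k)) (z : GenSum X Y) : ℝ :=
  sSup ((fun φ : GenSum X Y → 𝕜 => ‖φ z‖) '' genLambda N)

end GenSum

section Subspaces

variable {𝕜 : Type*} [RCLike 𝕜] {E : Type*} [NormedAddCommGroup E] [NormedSpace 𝕜 E]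

/-- For subspaces `X`, `Y` of `E`, the seminorm `(x, y) ↦ ‖x + y‖` on `X × Y`. -/
noncomputable def ambientNorm (X Y : Submodule 𝕜 E) : Seminorm 𝕜 (X × Y) :=
  (normSeminorm 𝕜 E).comp (X.subtype.coprod Y.subtype)

/-- `Z = Σ(W k)` inside `E`, where `W k = X ⊕ Y k` carries the norm of `E`: these norms are as
required in the definition of the generalized `ℓ²`-sum, and assigning to `(x, (y k))` the sum
`x + ∑ y k` in `E` is a linear isometry of `Σ(X ⊕ Y k)` onto `Z`. -/
def IsGenSum (Z : Submodule 𝕜 E) (W : ℕ → Submodule 𝕜 E) (X : Submodule 𝕜 E)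
    (Y : ℕ → Submodule 𝕜 E) : Prop :=
  (∀ k, Disjoint X (Y k) ∧ X ⊔ Y k = W k) ∧
  IsMonotoneSumNorm (fun k => ambientNorm X (Y k)) ∧
  ∃ Φ : GenSum X (fun k => Y k) ≃ₗ[𝕜] Z, ∀ z : GenSum X (fun k => Y k),
    HasSum (fun k => (z.2 k : E)) ((Φ z : E) - (z.1 : E)) ∧
    ‖Φ z‖ = genNorm (fun k => ambientNorm X (Y k)) z

/-- The closed linear span of the vectors `e η` with `η ∈ S`. -/
def closedSpan (e : List ℕ → E) (S : Set (List ℕ)) : Submodule 𝕜 E :=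
  (Submodule.span 𝕜 (e '' S)).topologicalClosure

end Subspaces

/-!
If the norm of `E_ν` is the generalized `ℓ²`-sum of the norms of the `E_{ν ++ [k]}` for every `ν`,
then the family of these norms, as seminorms on the finitely supported coefficient families, is a
fixed point of the operator `N ↦ glueNorm N` which replaces the seminorm at `ν` by the generalized
`ℓ²`-sum of the seminorms at the `ν ++ [k]`. This operator is monotone and preserves the
families that agree with `‖·‖_F` along branches, do not increase under restriction to trees and
inherit the inequalities in (d) from `F`. The norm of `F` along branches is a smallest such family,
all of them are bounded on unit vectors, and suprema of such families are again of this kind, so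
by Knaster–Tarski there is a fixed point of this kind. The space `E` is the completion for its
seminorm at the root.

The gluing at `ν` is only concerned with finite sums. An isometry on finite sums extends to `Σ`
because `∑ ‖y k‖ ^ 2` is controlled by the weights `α` in `Λ`, and its range is closed.
-/

section L2Weight

variable {ι : Type*} {α β : ι → ℝ}

/-- The coefficient sequences `α` of the functionals in `genLambda`: the nonnegative part of the
unit ball of `ℓ²`, described through finite sums so that no summability has to be carried along. -/
structure IsL2Weight (α : ι → ℝ) : Prop where
  nonneg : ∀ k, 0 ≤ α k
  sum_sq_le_one : ∀ K : Finset ι, ∑ k ∈ K, α k ^ 2 ≤ 1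

namespace IsL2Weight

theorem sq_le_one (hα : IsL2Weight α) (k : ι) : α k ^ 2 ≤ 1 := by
  simpa using hα.sum_sq_le_one {k}

theorem le_one (hα : IsL2Weight α) (k : ι) : α k ≤ 1 :=
  (sq_le_one_iff₀ (hα.nonneg k)).1 (hα.sq_le_one k)

theorem mono (hα : IsL2Weight α) (h0 : ∀ k, 0 ≤ β k) (h : ∀ k, β k ≤ α k) : IsL2Weight β where
  nonneg := h0
  sum_sq_le_one K :=
    (Finset.sum_le_sum fun k _ => pow_le_pow_left₀ (h0 k) (h k) 2).trans (hα.sum_sq_le_one K)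

theorem zero : IsL2Weight (0 : ι → ℝ) where
  nonneg _ := le_rfl
  sum_sq_le_one _ := by simp

theorem single [DecidableEq ι] (k : ι) : IsL2Weight (Pi.single k 1 : ι → ℝ) where
  nonneg j := by by_cases h : j = k <;> simp [h]
  sum_sq_le_one K := by
    simp only [Pi.single_apply, ite_pow, one_pow, ne_eq, OfNat.ofNat_ne_zero, not_false_eq_true,
      zero_pow, Finset.sum_ite_eq']
    split_ifs <;> norm_num

theorem sum_mul_norm_le {Y : ι → Type*} [∀ k, NormedAddCommGroup (Y k)] (hα : IsL2Weight α)
    (y : lp Y 2) (K : Finset ι) : ∑ k ∈ K, α k * ‖y k‖ ≤ ‖y‖ := by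
  have hy : ∑ k ∈ K, ‖y k‖ ^ 2 ≤ ‖y‖ ^ 2 := by
    exact_mod_cast lp.sum_rpow_le_norm_rpow (p := 2) (by simp) y K
  calc ∑ k ∈ K, α k * ‖y k‖
      ≤ √(∑ k ∈ K, α k ^ 2) * √(∑ k ∈ K, ‖y k‖ ^ 2) := Real.sum_mul_le_sqrt_mul_sqrt K _ _
    _ ≤ 1 * ‖y‖ := by
        gcongr
        · exact Real.sqrt_le_one.2 (hα.sum_sq_le_one K)
        · exact Real.sqrt_le_iff.2 ⟨norm_nonneg y, hy⟩
    _ = ‖y‖ := one_mul _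

end IsL2Weight

theorem isL2Weight_iff_tsum :
    IsL2Weight α ↔
      (∀ k, 0 ≤ α k ∧ α k ≤ 1) ∧ (Summable fun k => α k ^ 2) ∧ ∑' k, α k ^ 2 ≤ 1 := by
  refine ⟨fun hα => ?_, fun ⟨h01, hs, h1⟩ => ⟨fun k => (h01 k).1, fun K => ?_⟩⟩
  · have hs := summable_of_sum_le (fun k => sq_nonneg (α k)) hα.sum_sq_le_one
    exact ⟨fun k => ⟨hα.nonneg k, hα.le_one k⟩, hs, hs.tsum_le_of_sum_le hα.sum_sq_le_one⟩
  · exact (hs.sum_le_tsum K fun k _ => sq_nonneg _).trans h1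

theorem sum_sq_le_sq_of_forall_isL2Weight {a : ι → ℝ} {C : ℝ} {K : Finset ι}
    (ha : ∀ k, 0 ≤ a k)
    (h : ∀ α : ι → ℝ, IsL2Weight α → ∑ k ∈ K, α k * a k ≤ C) : ∑ k ∈ K, a k ^ 2 ≤ C ^ 2 := by
  classical
  set S := ∑ k ∈ K, a k ^ 2 with hS
  have hS0 : 0 ≤ S := Finset.sum_nonneg fun k _ => sq_nonneg _
  rcases hS0.eq_or_lt with hS0 | hS0
  · rw [← hS0]; positivity
  -- equality in Cauchy–Schwarz: the weight is `a` itself, restricted to `K` and normalized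
  let α : ι → ℝ := (K : Set ι).indicator fun k => a k / √S
  have hαw : IsL2Weight α := by
    refine ⟨Set.indicator_nonneg fun k _ => div_nonneg (ha k) (Real.sqrt_nonneg _), fun J => ?_⟩
    calc ∑ k ∈ J, α k ^ 2 = ∑ k ∈ J with k ∈ K, a k ^ 2 / S := by
          simp [α, Finset.sum_filter, Set.indicator_apply, ite_pow, div_pow, Real.sq_sqrt hS0.le]
      _ ≤ ∑ k ∈ K, a k ^ 2 / S :=
          Finset.sum_le_sum_of_subset_of_nonneg (fun k hk => (Finset.mem_filter.1 hk).2)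
            fun k _ _ => div_nonneg (sq_nonneg _) hS0.le
      _ = 1 := by rw [← Finset.sum_div, div_self hS0.ne']
  have hsum : ∑ k ∈ K, α k * a k = √S := by
    calc ∑ k ∈ K, α k * a k = ∑ k ∈ K, a k ^ 2 / √S :=
          Finset.sum_congr rfl fun k hk => by
            simp only [α, Set.indicator_of_mem (Finset.mem_coe.2 hk)]; ring
      _ = √S := by rw [← Finset.sum_div, ← hS, Real.div_sqrt]
  exact (Real.sqrt_le_left ((Real.sqrt_nonneg S).trans (hsum ▸ h α hαw))).1 (hsum ▸ h α hαw)

end L2Weight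

section GenNorm

variable {𝕜 : Type*} [RCLike 𝕜]
  {X : Type*} [NormedAddCommGroup X] [NormedSpace 𝕜 X]
  {Y : ℕ → Type*} [∀ k, NormedAddCommGroup (Y k)] [∀ k, NormedSpace 𝕜 (Y k)]
  {N : ∀ k, Seminorm 𝕜 (X × Y k)} {φ : GenSum X Y → 𝕜}

theorem mem_genLambda_iff :
    φ ∈ genLambda N ↔ ∃ (x' : StrongDual 𝕜 X) (y' : ∀ k, StrongDual 𝕜 (Y k)) (α : ℕ → ℝ),
      IsL2Weight α ∧ (∀ k (x : X) (y : Y k), ‖x' x + y' k y‖ ≤ N k (x, y)) ∧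
      ∀ z : GenSum X Y, φ z = x' z.1 + ∑' k, (α k : 𝕜) * y' k (z.2 k) := by
  simp only [genLambda, isL2Weight_iff_tsum, Set.mem_ofPred_eq]
  tauto

theorem zero_mem_genLambda : (fun _ => 0) ∈ genLambda N :=
  mem_genLambda_iff.2 ⟨0, 0, 0, .zero, by simp, by simp⟩

theorem genNorm_le {z : GenSum X Y} {C : ℝ} (h : ∀ φ ∈ genLambda N, ‖φ z‖ ≤ C) :
    genNorm N z ≤ C :=
  csSup_le ⟨_, Set.mem_image_of_mem _ zero_mem_genLambda⟩ (Set.forall_mem_image.2 h)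

theorem IsL2Weight.summable_mul_apply {α : ℕ → ℝ} (hα : IsL2Weight α)
    {y' : ∀ k, StrongDual 𝕜 (Y k)} (hy' : ∀ k y, ‖y' k y‖ ≤ ‖y‖) (y : lp Y 2) :
    Summable (fun k => (α k : 𝕜) * y' k (y k)) ∧ ‖∑' k, (α k : 𝕜) * y' k (y k)‖ ≤ ‖y‖ := by
  have hle (k : ℕ) : ‖(α k : 𝕜) * y' k (y k)‖ ≤ α k * ‖y k‖ := by
    rw [norm_mul, RCLike.norm_ofReal, abs_of_nonneg (hα.nonneg k)]
    exact mul_le_mul_of_nonneg_left (hy' k _) (hα.nonneg k)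
  have hs : Summable fun k => α k * ‖y k‖ :=
    summable_of_sum_le (fun k => mul_nonneg (hα.nonneg k) (norm_nonneg _)) (hα.sum_mul_norm_le y)
  exact ⟨.of_norm_bounded hs hle,
    (tsum_of_norm_bounded hs.hasSum hle).trans (hs.tsum_le_of_sum_le (hα.sum_mul_norm_le y))⟩

namespace IsMonotoneSumNorm

variable (hN : IsMonotoneSumNorm N)
include hN

theorem norm_left_apply_le {k : ℕ} {x' : StrongDual 𝕜 X} {y' : StrongDual 𝕜 (Y k)}
    (h : ∀ x y, ‖x' x + y' y‖ ≤ N k (x, y)) (x : X) : ‖x' x‖ ≤ ‖x‖ := by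
  simpa [hN.left] using h x 0

theorem norm_right_apply_le {k : ℕ} {x' : StrongDual 𝕜 X} {y' : StrongDual 𝕜 (Y k)}
    (h : ∀ x y, ‖x' x + y' y‖ ≤ N k (x, y)) (y : Y k) : ‖y' y‖ ≤ ‖y‖ := by
  simpa [hN.right] using h 0 y

theorem norm_right_le (k : ℕ) (x : X) (y : Y k) : ‖y‖ ≤ 2 * N k (x, y) := by
  have hsub : N k (0, y) ≤ N k (x, y) + N k (x, 0) := by
    simpa using map_sub_le_add (N k) (x, y) (x, 0)
  rw [hN.right, hN.left] at hsub
  linarith [hN.mono k x y]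

theorem exists_linearMap_of_mem_genLambda (hφ : φ ∈ genLambda N) :
    ∃ L : GenSum X Y →ₗ[𝕜] 𝕜, ⇑L = φ ∧ ∀ z, ‖L z‖ ≤ ‖z.1‖ + ‖z.2‖ := by
  obtain ⟨x', y', α, hα, hle, hφ⟩ := mem_genLambda_iff.1 hφ
  have hx' := hN.norm_left_apply_le (hle 0)
  have hs := hα.summable_mul_apply fun k => hN.norm_right_apply_le (hle k)
  refine ⟨{ toFun := φ, map_add' := fun z w => ?_, map_smul' := fun c z => ?_ }, rfl, fun z => ?_⟩
  · simp only [hφ, Prod.fst_add, Prod.snd_add, lp.coeFn_add, Pi.add_apply, map_add, mul_add,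
      (hs z.2).1.tsum_add (hs w.2).1]
    ring
  · simp only [hφ, Prod.smul_fst, Prod.smul_snd, lp.coeFn_smul, Pi.smul_apply, map_smul,
      smul_eq_mul, mul_left_comm _ c, tsum_mul_left, RingHom.id_apply]
    ring
  · exact (hφ z ▸ norm_add_le _ _).trans (add_le_add (hx' _) (hs _).2)

theorem bddAbove_genLambda (z : GenSum X Y) :
    BddAbove ((fun φ : GenSum X Y → 𝕜 => ‖φ z‖) '' genLambda N) := by
  refine ⟨‖z.1‖ + ‖z.2‖, Set.forall_mem_image.2 fun φ hφ => ?_⟩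
  obtain ⟨L, rfl, hL⟩ := hN.exists_linearMap_of_mem_genLambda hφ
  exact hL z

theorem norm_apply_le_genNorm (hφ : φ ∈ genLambda N) (z : GenSum X Y) : ‖φ z‖ ≤ genNorm N z :=
  le_csSup (hN.bddAbove_genLambda z) (Set.mem_image_of_mem _ hφ)

theorem genNorm_le_norm_add_norm (z : GenSum X Y) : genNorm N z ≤ ‖z.1‖ + ‖z.2‖ := by
  refine genNorm_le fun φ hφ => ?_
  obtain ⟨L, rfl, hL⟩ := hN.exists_linearMap_of_mem_genLambda hφ
  exact hL z

theorem genNorm_add_le (z w : GenSum X Y) : genNorm N (z + w) ≤ genNorm N z + genNorm N w := by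
  refine genNorm_le fun φ hφ => ?_
  obtain ⟨L, rfl, -⟩ := hN.exists_linearMap_of_mem_genLambda hφ
  rw [map_add]
  exact (norm_add_le _ _).trans
    (add_le_add (hN.norm_apply_le_genNorm hφ z) (hN.norm_apply_le_genNorm hφ w))

theorem continuous_genNorm : Continuous (genNorm N) := by
  refine (LipschitzWith.of_le_add_mul 2 fun z w => ?_).continuous
  calc genNorm N z = genNorm N (w + (z - w)) := by rw [add_sub_cancel]
    _ ≤ genNorm N w + genNorm N (z - w) := hN.genNorm_add_le _ _
    _ ≤ genNorm N w + (2 : NNReal) * dist z w := by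
        rw [dist_eq_norm, NNReal.coe_two, two_mul]
        gcongr
        exact (hN.genNorm_le_norm_add_norm _).trans
          (add_le_add (norm_fst_le (z - w)) (norm_snd_le (z - w)))

theorem norm_fst_le_genNorm (z : GenSum X Y) : ‖z.1‖ ≤ genNorm N z := by
  obtain ⟨x', hx', hz⟩ := exists_dual_vector'' 𝕜 z.1
  have hmem : (fun w => x' w.1) ∈ genLambda N :=
    mem_genLambda_iff.2 ⟨x', 0, 0, .zero, fun k x y => by
      simpa using (x'.le_of_opNorm_le hx' x).trans (by simpa using hN.mono k x y), by simp⟩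
  simpa [hz] using hN.norm_apply_le_genNorm hmem z

theorem sum_mul_norm_snd_le_genNorm {α : ℕ → ℝ} (hα : IsL2Weight α) (z : GenSum X Y)
    (K : Finset ℕ) : ∑ k ∈ K, α k * ‖z.2 k‖ ≤ 2 * genNorm N z := by
  choose y' hy' hz using fun k => exists_dual_vector'' 𝕜 (z.2 k)
  -- half a norming functional of `Y k` has dual norm at most one on `X ⊕ Y k`
  have hmem : (fun w => ∑' k, (α k : 𝕜) * ((2⁻¹ : 𝕜) • y' k) (w.2 k)) ∈ genLambda N := by
    refine mem_genLambda_iff.2 ⟨0, fun k => (2⁻¹ : 𝕜) • y' k, α, hα, fun k x y => ?_, by simp⟩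
    have := ((y' k).le_of_opNorm_le (hy' k) y).trans (one_mul ‖y‖).le
    rw [zero_apply, zero_add, smul_apply, norm_smul, norm_inv, RCLike.norm_ofNat]
    linarith [hN.norm_right_le k x y]
  have hvalue : ∑' k, (α k : 𝕜) * ((2⁻¹ : 𝕜) • y' k) (z.2 k) =
      ((2⁻¹ * ∑' k, α k * ‖z.2 k‖ : ℝ) : 𝕜) := by
    simp only [smul_apply, hz, smul_eq_mul, mul_left_comm _ (2⁻¹ : 𝕜), tsum_mul_left]
    push_cast
    rfl
  have hterm (k : ℕ) : 0 ≤ α k * ‖z.2 k‖ := mul_nonneg (hα.nonneg k) (norm_nonneg _)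
  have hs : Summable fun k => α k * ‖z.2 k‖ := summable_of_sum_le hterm (hα.sum_mul_norm_le z.2)
  have hle := hN.norm_apply_le_genNorm hmem z
  rw [hvalue, RCLike.norm_ofReal] at hle
  linarith [le_abs_self (2⁻¹ * ∑' k, α k * ‖z.2 k‖), hs.sum_le_tsum K fun k _ => hterm k]

theorem norm_snd_le_genNorm (z : GenSum X Y) : ‖z.2‖ ≤ 2 * genNorm N z := by
  have h0 : 0 ≤ genNorm N z := (norm_nonneg _).trans (hN.norm_fst_le_genNorm z)
  refine lp.norm_le_of_forall_sum_le (by simp) (by positivity) fun K => ?_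
  exact_mod_cast sum_sq_le_sq_of_forall_isL2Weight (fun k => norm_nonneg _)
    fun α hα => hN.sum_mul_norm_snd_le_genNorm hα z K

end IsMonotoneSumNorm

end GenNorm

section IsGenSum

variable {𝕜 : Type*} [RCLike 𝕜] {E : Type*} [NormedAddCommGroup E] [NormedSpace 𝕜 E]
  {X : Submodule 𝕜 E} {Y : ℕ → Submodule 𝕜 E}

theorem ambientNorm_apply (X Y : Submodule 𝕜 E) (x : X) (y : Y) :
    ambientNorm X Y (x, y) = ‖(x : E) + y‖ := rfl

theorem isMonotoneSumNorm_ambientNorm (hmono : ∀ k, ∀ x ∈ X, ∀ y ∈ Y k, ‖x‖ ≤ ‖x + y‖) :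
    IsMonotoneSumNorm fun k => ambientNorm X (Y k) where
  left k x := by simp [ambientNorm_apply]
  right k y := by simp [ambientNorm_apply]
  mono k x y := hmono k x x.2 y y.2

/-- The norm of `E` on finite sums `x + ∑ k ∈ K, y k` is that of the generalized `ℓ²`-sum of the
spaces `X ⊕ Y k ⊆ E`. -/
def FiniteSumsHaveGenNorm (X : Submodule 𝕜 E) (Y : ℕ → Submodule 𝕜 E) : Prop :=
  ∀ (K : Finset ℕ) (x : X) (y : ∀ k, Y k),
    ‖(x : E) + ∑ k ∈ K, (y k : E)‖ =
      genNorm (fun k => ambientNorm X (Y k)) (x, ∑ k ∈ K, lp.single 2 k (y k))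

section Complete

variable [CompleteSpace E] (hN : IsMonotoneSumNorm fun k => ambientNorm X (Y k))
  (hfin : FiniteSumsHaveGenNorm X Y)
include hN hfin

theorem FiniteSumsHaveGenNorm.summable (y : lp (fun k => Y k) 2) :
    Summable fun k => (y k : E) := by
  have hsingle := (lp.hasSum_single (p := 2) (by simp) y).summable
  refine summable_iff_vanishing_norm.2 fun ε hε => ?_
  obtain ⟨J, hJ⟩ := hsingle.vanishing (Metric.ball_mem_nhds 0 hε)
  refine ⟨J, fun K hK => ?_⟩
  calc ‖∑ k ∈ K, (y k : E)‖
      = genNorm (fun k => ambientNorm X (Y k)) (0, ∑ k ∈ K, lp.single 2 k (y k)) := by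
        simpa using hfin K 0 fun k => y k
    _ ≤ ‖∑ k ∈ K, lp.single 2 k (y k)‖ := by
        simpa only [norm_zero, zero_add] using
          hN.genNorm_le_norm_add_norm (0, ∑ k ∈ K, lp.single 2 k (y k))
    _ < ε := mem_ball_zero_iff.1 (hJ K hK)

/-- The map `(x, y) ↦ x + ∑ y k` from a generalized `ℓ²`-sum of subspaces of `E` to `E`. -/
noncomputable def genSumMap : GenSum X (fun k => Y k) →ₗ[𝕜] E where
  toFun z := z.1 + ∑' k, (z.2 k : E)
  map_add' z w := by
    simp only [Prod.fst_add, Prod.snd_add, lp.coeFn_add, Pi.add_apply, Submodule.coe_add,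
      (hfin.summable hN z.2).tsum_add (hfin.summable hN w.2)]
    abel
  map_smul' c z := by
    simp only [Prod.smul_fst, Prod.smul_snd, lp.coeFn_smul, Pi.smul_apply, Submodule.coe_smul,
      (hfin.summable hN z.2).tsum_const_smul c, smul_add, RingHom.id_apply]

theorem hasSum_genSumMap_sub (z : GenSum X (fun k => Y k)) :
    HasSum (fun k => (z.2 k : E)) (genSumMap hN hfin z - z.1) := by
  have : genSumMap hN hfin z - z.1 = ∑' k, (z.2 k : E) := add_sub_cancel_left _ _
  exact this ▸ (hfin.summable hN z.2).hasSum

theorem norm_genSumMap (z : GenSum X (fun k => Y k)) :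
    ‖genSumMap hN hfin z‖ = genNorm (fun k => ambientNorm X (Y k)) z := by
  have hE : Tendsto (fun K => (z.1 : E) + ∑ k ∈ K, (z.2 k : E)) atTop
      (𝓝 (genSumMap hN hfin z)) := by
    simpa using (hasSum_genSumMap_sub hN hfin z).const_add (z.1 : E)
  have hS : Tendsto (fun K => (z.1, ∑ k ∈ K, lp.single 2 k (z.2 k))) atTop (𝓝 z) :=
    tendsto_const_nhds.prodMk_nhds (lp.hasSum_single (p := 2) (by simp) z.2)
  refine tendsto_nhds_unique hE.norm ?_
  simpa only [hfin _ z.1 fun k => z.2 k, Function.comp_def] using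
    (hN.continuous_genNorm.tendsto z).comp hS

theorem antilipschitzWith_genSumMap : AntilipschitzWith 2 (genSumMap hN hfin) := by
  refine AddMonoidHomClass.antilipschitz_of_bound _ fun z => ?_
  rw [norm_genSumMap, NNReal.coe_ofNat]
  have h1 := hN.norm_fst_le_genNorm z
  exact max_le (by linarith [norm_nonneg z.1]) (hN.norm_snd_le_genNorm z)

theorem isClosed_range_genSumMap (hX : IsClosed (X : Set E)) (hY : ∀ k, IsClosed (Y k : Set E)) :
    IsClosed (LinearMap.range (genSumMap hN hfin) : Set E) := by
  have := hX.completeSpace_coe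
  have := fun k => (hY k).completeSpace_coe
  have hbound (z : GenSum X (fun k => Y k)) : ‖genSumMap hN hfin z‖ ≤ 2 * ‖z‖ := by
    rw [norm_genSumMap, two_mul]
    exact (hN.genNorm_le_norm_add_norm z).trans (add_le_add (norm_fst_le z) (norm_snd_le z))
  exact (antilipschitzWith_genSumMap hN hfin).isClosed_range
    ((genSumMap hN hfin).mkContinuous 2 hbound).uniformContinuous

theorem range_genSumMap (hX : IsClosed (X : Set E)) (hY : ∀ k, IsClosed (Y k : Set E)) :
    LinearMap.range (genSumMap hN hfin) = (X ⊔ ⨆ k, Y k).topologicalClosure := by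
  have hsup : X ≤ X ⊔ ⨆ k, Y k := le_sup_left
  have hsup' (k : ℕ) : Y k ≤ X ⊔ ⨆ k, Y k := (le_iSup Y k).trans le_sup_right
  refine le_antisymm ?_ (Submodule.topologicalClosure_minimal _ (sup_le ?_ (iSup_le ?_))
    (isClosed_range_genSumMap hN hfin hX hY))
  · rintro _ ⟨z, rfl⟩
    refine add_mem (Submodule.le_topologicalClosure _ (hsup z.1.2)) ?_
    refine mem_closure_of_tendsto (hfin.summable hN z.2).hasSum (.of_forall fun K => ?_)
    exact sum_mem fun k _ => hsup' k (z.2 k).2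
  · exact fun x hx => ⟨(⟨x, hx⟩, 0), by simp [genSumMap]⟩
  · refine fun k y hy => ⟨(0, lp.single 2 k ⟨y, hy⟩), ?_⟩
    have hne (j : ℕ) (hj : j ≠ k) :
        (lp.single (E := fun k => Y k) 2 k ⟨y, hy⟩ j : E) = 0 := by
      rw [lp.single_apply_ne _ _ _ hj, Submodule.coe_zero]
    change ((0 : X) : E) + ∑' j, (lp.single (E := fun k => Y k) 2 k ⟨y, hy⟩ j : E) = y
    rw [tsum_eq_single k hne, lp.single_apply_self, Submodule.coe_zero, zero_add]

theorem FiniteSumsHaveGenNorm.isGenSum (hX : IsClosed (X : Set E))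
    (hY : ∀ k, IsClosed (Y k : Set E)) :
    IsGenSum (X ⊔ ⨆ k, Y k).topologicalClosure (fun k => X ⊔ Y k) X Y := by
  refine ⟨fun k => ⟨Submodule.disjoint_def.2 fun x hx hx' => ?_, rfl⟩, hN, ?_⟩
  · simpa [ambientNorm_apply] using hN.mono k ⟨x, hx⟩ (-⟨x, hx'⟩)
  · refine ⟨(LinearEquiv.ofInjective _ (antilipschitzWith_genSumMap hN hfin).injective).trans
      (LinearEquiv.ofEq _ _ (range_genSumMap hN hfin hX hY)), fun z => ?_⟩
    exact ⟨hasSum_genSumMap_sub hN hfin z, norm_genSumMap hN hfin z⟩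

end Complete

end IsGenSum

section Sequences

variable {ν μ η : List ℕ} {j k : ℕ}

/-- The set of initial segments of `ν`. -/
def prefixes (ν : List ℕ) : Set (List ℕ) := {η | η <+: ν}

/-- The set of sequences extending `ν`. -/
def cone (ν : List ℕ) : Set (List ℕ) := {η | ν <+: η}

/-- The set of sequences comparable with `ν`, the index set of `E_ν`. -/
def comparable (ν : List ℕ) : Set (List ℕ) := {η | η <+: ν ∨ ν <+: η}

theorem isSeqTree_prefixes (ν : List ℕ) : IsSeqTree (prefixes ν) :=
  fun _ _ h h' => h.trans h'

theorem isSeqTree_comparable (ν : List ℕ) : IsSeqTree (comparable ν) := by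
  rintro η μ h (h' | h')
  · exact Or.inl (h.trans h')
  · exact List.prefix_or_prefix_of_prefix h h'

theorem prefixes_subset_prefixes (h : ν <+: μ) : prefixes ν ⊆ prefixes μ :=
  fun _ h' => h'.trans h

theorem prefixes_subset_comparable (ν : List ℕ) : prefixes ν ⊆ comparable ν :=
  fun _ => Or.inl

theorem cone_concat_subset_comparable (ν : List ℕ) (k : ℕ) : cone (ν ++ [k]) ⊆ comparable ν :=
  fun _ h => Or.inr ((List.prefix_append _ _).trans h)

theorem comparable_nil : comparable [] = Set.univ :=
  Set.eq_univ_of_forall fun η => Or.inr (List.nil_prefix (l := η))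

theorem comparable_concat (ν : List ℕ) (k : ℕ) :
    comparable (ν ++ [k]) = prefixes ν ∪ cone (ν ++ [k]) := by
  ext η
  constructor
  · rintro (h | h)
    · exact (List.prefix_concat_iff.1 h).elim (fun h => Or.inr (h ▸ List.prefix_rfl)) Or.inl
    · exact Or.inr h
  · exact Or.imp_left fun h => h.trans (List.prefix_append _ _)

theorem comparable_eq_prefixes_union_iUnion (ν : List ℕ) :
    comparable ν = prefixes ν ∪ ⋃ k, cone (ν ++ [k]) := by
  refine Set.Subset.antisymm ?_ (Set.union_subset (prefixes_subset_comparable ν)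
    (Set.iUnion_subset (cone_concat_subset_comparable ν)))
  rintro _ (h | ⟨_ | ⟨k, t⟩, rfl⟩)
  · exact Or.inl h
  · exact Or.inl (by simp [prefixes])
  · exact Or.inr (Set.mem_iUnion.2 ⟨k, t, by simp⟩)

theorem comparable_concat_subset (ν : List ℕ) (k : ℕ) :
    comparable (ν ++ [k]) ⊆ comparable ν := by
  rw [comparable_concat]
  exact Set.union_subset (prefixes_subset_comparable ν) (cone_concat_subset_comparable ν k)

theorem disjoint_prefixes_cone_concat (ν : List ℕ) (k : ℕ) :
    Disjoint (prefixes ν) (cone (ν ++ [k])) :=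
  Set.disjoint_left.2 fun η (h : η <+: ν) (h' : ν ++ [k] <+: η) => by
    simpa using (h'.trans h).length_le

theorem disjoint_cone_concat (ν : List ℕ) (hjk : j ≠ k) :
    Disjoint (cone (ν ++ [j])) (cone (ν ++ [k])) :=
  Set.disjoint_left.2 fun η (h : ν ++ [j] <+: η) (h' : ν ++ [k] <+: η) => hjk <| by
    simpa using List.prefix_of_prefix_length_le h h' (by simp)

theorem comparable_diff_prefixes (ν : List ℕ) :
    comparable ν \ prefixes ν = {η | ν <+: η ∧ η ≠ ν} := by
  ext η
  refine ⟨fun ⟨h, h'⟩ => ⟨h.resolve_left h', ?_⟩, fun ⟨h, h'⟩ => ⟨Or.inr h, fun h'' => ?_⟩⟩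
  · rintro rfl
    exact h' List.prefix_rfl
  · exact h' (h''.eq_of_length_le h.length_le)

theorem IsSeqTree.exists_inter_prefixes_eq {T : Set (List ℕ)} (hT : IsSeqTree T) (ν : List ℕ) :
    ∃ n, T ∩ prefixes ν = {η | η.length < n} ∩ prefixes ν := by
  induction ν using List.reverseRecOn with
  | nil =>
    by_cases h : [] ∈ T
    · exact ⟨1, Set.ext fun η => and_congr_left fun hη => by simp [List.prefix_nil.1 hη, h]⟩
    · exact ⟨0, Set.ext fun η => and_congr_left fun hη => by simp [List.prefix_nil.1 hη, h]⟩
  | append_singleton ν k ih =>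
    by_cases h : ν ++ [k] ∈ T
    · refine ⟨ν.length + 2, Set.ext fun η => and_congr_left fun hη => ?_⟩
      have := List.IsPrefix.length_le hη
      simp only [List.length_append, List.length_singleton] at this
      exact iff_of_true (hT hη h) (by simp only [Set.mem_ofPred_eq]; omega)
    · obtain ⟨n, hn⟩ := ih
      refine ⟨min n (ν.length + 1), Set.ext fun η => and_congr_left fun hη => ?_⟩
      rcases List.prefix_concat_iff.1 hη with rfl | hην
      · simp [h]
      · simpa [prefixes, hην, hην.length_le] using Set.ext_iff.1 hn η

theorem prefixes_subset_setOf_length_lt (ν : List ℕ) :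
    prefixes ν ⊆ {η | η.length < ν.length + 1} :=
  fun _ h => Nat.lt_succ_of_le (List.IsPrefix.length_le h)

theorem setOf_length_lt_inter_prefixes (h : ν <+: μ) :
    {η | η.length < ν.length + 1} ∩ prefixes μ = prefixes ν :=
  Set.Subset.antisymm
    (fun _ hη => List.prefix_of_prefix_length_le hη.2 h (Nat.le_of_lt_succ hη.1))
    (Set.subset_inter (prefixes_subset_setOf_length_lt ν) (prefixes_subset_prefixes h))

end Sequences

section Restriction

variable {ι R : Type*} [Semiring R] {S T : Set ι}

open Classical in
/-- Restriction of the support of a finitely supported function to the index set `S`. -/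
noncomputable def restr (S : Set ι) : (ι →₀ R) →ₗ[R] ι →₀ R where
  toFun v := v.filter (· ∈ S)
  map_add' _ _ := Finsupp.filter_add
  map_smul' c v := Finsupp.filter_smul (p := (· ∈ S)) (b := c) (v := v)

theorem restr_apply (S : Set ι) (v : ι →₀ R) (i : ι) : restr S v i = S.indicator v i := by
  classical
  rw [Set.indicator_apply]
  exact Finsupp.filter_apply _ _ _

theorem restr_single_of_mem {i : ι} (h : i ∈ S) (c : R) :
    restr S (Finsupp.single i c) = Finsupp.single i c := by
  classical exact Finsupp.filter_single_of_pos (· ∈ S) h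

theorem restr_single_of_notMem {i : ι} (h : i ∉ S) (c : R) :
    restr S (Finsupp.single i c) = 0 := by
  classical exact Finsupp.filter_single_of_neg (· ∈ S) h

theorem restr_restr (S T : Set ι) (v : ι →₀ R) : restr S (restr T v) = restr (S ∩ T) v := by
  ext i
  by_cases hS : i ∈ S <;> by_cases hT : i ∈ T <;> simp [restr_apply, hS, hT]

theorem restr_comm (S T : Set ι) (v : ι →₀ R) : restr S (restr T v) = restr T (restr S v) := by
  rw [restr_restr, restr_restr, Set.inter_comm]

theorem restr_restr_of_subset (h : S ⊆ T) (v : ι →₀ R) : restr S (restr T v) = restr S v := by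
  rw [restr_restr, Set.inter_eq_left.2 h]

theorem restr_restr_of_superset (h : S ⊆ T) (v : ι →₀ R) : restr T (restr S v) = restr S v := by
  rw [restr_restr, Set.inter_eq_right.2 h]

theorem restr_restr_self (S : Set ι) (v : ι →₀ R) : restr S (restr S v) = restr S v :=
  restr_restr_of_subset subset_rfl v

theorem restr_restr_of_disjoint (h : Disjoint S T) (v : ι →₀ R) : restr S (restr T v) = 0 := by
  ext i
  simp [restr_restr, h.inter_eq, restr_apply]

theorem restr_univ (v : ι →₀ R) : restr Set.univ v = v := by
  ext i
  simp [restr_apply]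

theorem restr_union (h : Disjoint S T) (v : ι →₀ R) :
    restr (S ∪ T) v = restr S v + restr T v := by
  ext i
  simp [restr_apply, Set.indicator_union_of_disjoint h]

theorem restr_finset (A : Finset ι) (v : ι →₀ R) :
    restr (A : Set ι) v = ∑ i ∈ A, Finsupp.single i (v i) := by
  classical
  ext j
  simp [restr_apply, Set.indicator_apply, Finsupp.single_apply, Finsupp.finsetSum_apply]

theorem restr_of_support_subset {v : ι →₀ R} (h : (v.support : Set ι) ⊆ S) : restr S v = v := by
  ext i
  rw [restr_apply, Set.indicator_eq_self.2 (by rwa [Finsupp.fun_support_eq])]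

theorem restr_diff {R : Type*} [Ring R] (h : S ⊆ T) (v : ι →₀ R) :
    restr (T \ S) v = restr T v - restr S v := by
  rw [eq_sub_iff_add_eq', ← restr_union Set.disjoint_sdiff_right, Set.union_sdiff_cancel h]

end Restriction

section BranchNorm

variable {𝕜 : Type*} [RCLike 𝕜] {F : Type*} [NormedAddCommGroup F] [NormedSpace 𝕜 F]
  (f : SchauderBasis 𝕜 F) {μ ν : List ℕ}

/-- The linear map sending the unit vector at `η` to the basis vector of `F` with index `|η|`. -/
noncomputable def lengthMap : (List ℕ →₀ 𝕜) →ₗ[𝕜] F :=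
  Finsupp.linearCombination 𝕜 fun η => f η.length

/-- The norm of `F` read along the branch that ends at `ν`. -/
noncomputable def branchNorm (ν : List ℕ) : Seminorm 𝕜 (List ℕ →₀ 𝕜) :=
  (normSeminorm 𝕜 F).comp ((lengthMap f).comp (restr (prefixes ν)))

theorem branchNorm_apply (ν : List ℕ) (v : List ℕ →₀ 𝕜) :
    branchNorm f ν v = ‖lengthMap f (restr (prefixes ν) v)‖ := rfl

theorem proj_lengthMap (n : ℕ) (v : List ℕ →₀ 𝕜) :
    SchauderBasis.proj f n (lengthMap f v) = lengthMap f (restr {η | η.length < n} v) := by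
  refine LinearMap.congr_fun (f := (SchauderBasis.proj f n : F →ₗ[𝕜] F).comp (lengthMap f))
    (g := (lengthMap f).comp (restr {η | η.length < n})) (Finsupp.lhom_ext fun η c => ?_) v
  simp only [LinearMap.comp_apply, ContinuousLinearMap.coe_coe, lengthMap,
    Finsupp.linearCombination_single, map_smul, SchauderBasis.proj_apply_basis_mem]
  by_cases hη : η ∈ {η : List ℕ | η.length < n}
  · rw [restr_single_of_mem hη, Finsupp.linearCombination_single, if_pos (Set.mem_ofPred.1 hη)]
  · rw [restr_single_of_notMem hη, map_zero, if_neg (mt Set.mem_ofPred.2 hη), smul_zero]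

theorem branchNorm_restr_prefixes (h : ν <+: μ) (v : List ℕ →₀ 𝕜) :
    branchNorm f μ (restr (prefixes ν) v) = branchNorm f ν v := by
  rw [branchNorm_apply, restr_restr_of_superset (prefixes_subset_prefixes h), branchNorm_apply]

theorem proj_lengthMap_restr_prefixes (h : ν <+: μ) (v : List ℕ →₀ 𝕜) :
    SchauderBasis.proj f (ν.length + 1) (lengthMap f (restr (prefixes μ) v)) =
      lengthMap f (restr (prefixes ν) v) := by
  rw [proj_lengthMap, restr_restr, setOf_length_lt_inter_prefixes h]

theorem branchNorm_single_le (ν η : List ℕ) :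
    branchNorm f ν (Finsupp.single η 1) ≤ ‖f η.length‖ := by
  by_cases hη : η ∈ prefixes ν
  · simp [branchNorm_apply, restr_single_of_mem hη, lengthMap]
  · simp [branchNorm_apply, restr_single_of_notMem hη]

variable {f}

theorem branchNorm_restr_le (hf : ∀ n, ‖SchauderBasis.proj f n‖ ≤ 1) {T : Set (List ℕ)}
    (hT : IsSeqTree T) (ν : List ℕ) (v : List ℕ →₀ 𝕜) :
    branchNorm f ν (restr T v) ≤ branchNorm f ν v := by
  obtain ⟨n, hn⟩ := hT.exists_inter_prefixes_eq ν
  rw [branchNorm_apply, restr_comm, restr_restr, hn, ← restr_restr, ← proj_lengthMap,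
    branchNorm_apply]
  simpa using (SchauderBasis.proj f n).le_of_opNorm_le (hf n) _

end BranchNorm

section Gluing

variable {𝕜 : Type*} [RCLike 𝕜] {N N' : List ℕ → Seminorm 𝕜 (List ℕ →₀ 𝕜)} {ν : List ℕ}
  {α : ℕ → ℝ} {ψ : ℕ → (List ℕ →₀ 𝕜) →ₗ[𝕜] 𝕜} {φ : (List ℕ →₀ 𝕜) →ₗ[𝕜] 𝕜} {b : List ℕ → ℝ}

/-- `φ` is the functional `x' + ∑ α k • y' k` of the set `Λ` at the node `ν`. The pair
`x' + y' k` is encoded as a single functional `ψ k`, dominated by the norm at `ν ++ [k]`; all of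
these have the same restriction `x'` to the initial segments of `ν`. -/
structure IsGluing (N : List ℕ → Seminorm 𝕜 (List ℕ →₀ 𝕜)) (ν : List ℕ) (α : ℕ → ℝ)
    (ψ : ℕ → (List ℕ →₀ 𝕜) →ₗ[𝕜] 𝕜) (φ : (List ℕ →₀ 𝕜) →ₗ[𝕜] 𝕜) : Prop where
  weight : IsL2Weight α
  norm_le : ∀ k v, ‖ψ k v‖ ≤ N (ν ++ [k]) v
  map_restr_prefixes : ∀ k v, φ (restr (prefixes ν) v) = ψ k (restr (prefixes ν) v)
  map_restr_cone : ∀ k v,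
    φ (restr (cone (ν ++ [k])) v) = α k * ψ k (restr (cone (ν ++ [k])) v)
  map_restr_comparable : ∀ v, φ (restr (comparable ν) v) = φ v

/-- The functionals that norm the generalized `ℓ²`-sum at `ν` of the seminorms at `ν ++ [k]`. -/
def IsGlued (N : List ℕ → Seminorm 𝕜 (List ℕ →₀ 𝕜)) (ν : List ℕ)
    (φ : (List ℕ →₀ 𝕜) →ₗ[𝕜] 𝕜) : Prop :=
  ∃ α ψ, IsGluing N ν α ψ φ

/-- The seminorm at `ν` of the generalized `ℓ²`-sum of the seminorms at `ν ++ [k]`. -/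
noncomputable def glueNorm (N : List ℕ → Seminorm 𝕜 (List ℕ →₀ 𝕜)) (ν : List ℕ) :
    Seminorm 𝕜 (List ℕ →₀ 𝕜) :=
  ⨆ φ : {φ // IsGlued N ν φ}, (normSeminorm 𝕜 𝕜).comp φ.1

theorem IsGlued.mono (h : ∀ ν, N ν ≤ N' ν) (hφ : IsGlued N ν φ) : IsGlued N' ν φ :=
  let ⟨α, ψ, hψ⟩ := hφ
  ⟨α, ψ, { hψ with norm_le := fun k v => (hψ.norm_le k v).trans (h _ v) }⟩

theorem isGlued_zero (N : List ℕ → Seminorm 𝕜 (List ℕ →₀ 𝕜)) (ν : List ℕ) : IsGlued N ν 0 :=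
  ⟨0, 0, .zero, by simp, by simp, by simp, by simp⟩

theorem IsGlued.comp_restr (hφ : IsGlued N ν φ) {T : Set (List ℕ)}
    (hT : ∀ μ v, N μ (restr T v) ≤ N μ v) : IsGlued N ν (φ.comp (restr T)) := by
  obtain ⟨α, ψ, hψ⟩ := hφ
  refine ⟨α, fun k => (ψ k).comp (restr T), hψ.weight, fun k v => ?_, fun k v => ?_,
    fun k v => ?_, fun v => ?_⟩
  · exact (hψ.norm_le k _).trans (hT _ v)
  all_goals simp only [LinearMap.comp_apply, restr_comm T]
  · exact hψ.map_restr_prefixes k _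
  · exact hψ.map_restr_cone k _
  · exact hψ.map_restr_comparable _

theorem IsGlued.smul (hφ : IsGlued N ν φ) {θ : 𝕜} (hθ : ‖θ‖ ≤ 1) : IsGlued N ν (θ • φ) := by
  obtain ⟨α, ψ, hψ⟩ := hφ
  refine ⟨α, fun k => θ • ψ k, hψ.weight, fun k v => ?_, fun k v => ?_, fun k v => ?_,
    fun v => ?_⟩
  · rw [LinearMap.smul_apply, norm_smul]
    exact (mul_le_of_le_one_left (norm_nonneg _) hθ).trans (hψ.norm_le k v)
  · rw [LinearMap.smul_apply, LinearMap.smul_apply, hψ.map_restr_prefixes k]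
  · rw [LinearMap.smul_apply, LinearMap.smul_apply, hψ.map_restr_cone, smul_eq_mul, smul_eq_mul,
      mul_left_comm]
  · rw [LinearMap.smul_apply, LinearMap.smul_apply, hψ.map_restr_comparable]

theorem IsGluing.norm_map_restr_cone_le (hφ : IsGluing N ν α ψ φ) (k : ℕ) (v : List ℕ →₀ 𝕜) :
    ‖φ (restr (cone (ν ++ [k])) v)‖ ≤ N (ν ++ [k]) (restr (cone (ν ++ [k])) v) := by
  rw [hφ.map_restr_cone, norm_mul, RCLike.norm_ofReal, abs_of_nonneg (hφ.weight.nonneg k)]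
  exact (mul_le_of_le_one_left (norm_nonneg _) (hφ.weight.le_one k)).trans (hφ.norm_le k _)

theorem IsGlued.norm_single_le (hN : ∀ ν η, N ν (Finsupp.single η 1) ≤ b η)
    (hφ : IsGlued N ν φ) (η : List ℕ) : ‖φ (Finsupp.single η 1)‖ ≤ b η := by
  obtain ⟨α, ψ, hψ⟩ := hφ
  by_cases hη : η ∈ comparable ν
  · rw [comparable_eq_prefixes_union_iUnion, Set.mem_union, Set.mem_iUnion] at hη
    rcases hη with hη | ⟨k, hη⟩
    · rw [← restr_single_of_mem hη, hψ.map_restr_prefixes 0, restr_single_of_mem hη]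
      exact (hψ.norm_le 0 _).trans (hN _ η)
    · have h := hψ.norm_map_restr_cone_le k (Finsupp.single η 1)
      rw [restr_single_of_mem hη] at h
      exact h.trans (hN _ η)
  · rw [← hψ.map_restr_comparable, restr_single_of_notMem hη, map_zero, norm_zero]
    exact (apply_nonneg _ _).trans (hN ν η)

theorem seminorm_apply_le_sum {ι : Type*} (p : Seminorm 𝕜 (ι →₀ 𝕜)) (v : ι →₀ 𝕜) :
    p v ≤ ∑ i ∈ v.support, ‖v i‖ * p (Finsupp.single i 1) := by
  calc p v = p (∑ i ∈ v.support, v i • Finsupp.single i 1) := by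
        conv_lhs => rw [← v.sum_single]
        simp [Finsupp.sum]
    _ ≤ ∑ i ∈ v.support, p (v i • Finsupp.single i 1) :=
        Finset.le_sum_of_subadditive p (map_zero p).le (map_add_le_add p) _ _
    _ = ∑ i ∈ v.support, ‖v i‖ * p (Finsupp.single i 1) := by simp only [map_smul_eq_mul]

theorem bddAbove_range_of_single_le {ι κ : Type*} {p : κ → Seminorm 𝕜 (ι →₀ 𝕜)} {b : ι → ℝ}
    (h : ∀ j i, p j (Finsupp.single i 1) ≤ b i) : BddAbove (Set.range p) := by
  refine Seminorm.bddAbove_range_iff.2 fun v => ⟨∑ i ∈ v.support, ‖v i‖ * b i, ?_⟩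
  rintro _ ⟨j, rfl⟩
  refine (seminorm_apply_le_sum (p j) v).trans (Finset.sum_le_sum fun i _ => ?_)
  exact mul_le_mul_of_nonneg_left (h j i) (norm_nonneg _)

section Bounded

variable (hN : ∀ ν η, N ν (Finsupp.single η 1) ≤ b η)
include hN

theorem bddAbove_glueNorm (ν : List ℕ) :
    BddAbove (Set.range fun φ : {φ // IsGlued N ν φ} => (normSeminorm 𝕜 𝕜).comp φ.1) :=
  bddAbove_range_of_single_le fun φ η => φ.2.norm_single_le hN η

theorem IsGlued.norm_apply_le_glueNorm (hφ : IsGlued N ν φ) (v : List ℕ →₀ 𝕜) :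
    ‖φ v‖ ≤ glueNorm N ν v :=
  le_ciSup (bddAbove_glueNorm hN ν) ⟨φ, hφ⟩ v

theorem glueNorm_le {v : List ℕ →₀ 𝕜} {C : ℝ} (h : ∀ φ, IsGlued N ν φ → ‖φ v‖ ≤ C) :
    glueNorm N ν v ≤ C := by
  have : Nonempty {φ // IsGlued N ν φ} := ⟨⟨0, isGlued_zero N ν⟩⟩
  rw [glueNorm, Seminorm.iSup_apply (bddAbove_glueNorm hN ν)]
  exact ciSup_le fun φ => h φ.1 φ.2

theorem glueNorm_mono (hN' : ∀ ν η, N' ν (Finsupp.single η 1) ≤ b η) (h : ∀ ν, N ν ≤ N' ν)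
    (ν : List ℕ) : glueNorm N ν ≤ glueNorm N' ν := fun v =>
  glueNorm_le hN fun _ hφ => (hφ.mono h).norm_apply_le_glueNorm hN' v

theorem glueNorm_single_le (ν η : List ℕ) : glueNorm N ν (Finsupp.single η 1) ≤ b η :=
  glueNorm_le hN fun _ hφ => hφ.norm_single_le hN η

theorem glueNorm_restr_le {T : Set (List ℕ)} (hT : ∀ μ v, N μ (restr T v) ≤ N μ v)
    (ν : List ℕ) (v : List ℕ →₀ 𝕜) : glueNorm N ν (restr T v) ≤ glueNorm N ν v :=
  glueNorm_le hN fun _ hφ => (hφ.comp_restr hT).norm_apply_le_glueNorm hN v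

end Bounded

end Gluing

section TreeNorm

variable {𝕜 : Type*} [RCLike 𝕜] {F : Type*} [NormedAddCommGroup F] [NormedSpace 𝕜 F]
  {f : SchauderBasis 𝕜 F} {N : List ℕ → Seminorm 𝕜 (List ℕ →₀ 𝕜)} {μ ν : List ℕ} {c : ℝ}
  {φ : (List ℕ →₀ 𝕜) →ₗ[𝕜] 𝕜}

/-- The hypothesis of part (d): the partial sum projection of length `l + 1` splits the norm of `F`
with constant `c`. -/
def IsSplitting (f : SchauderBasis 𝕜 F) (l : ℕ) (c : ℝ) : Prop :=
  0 < c ∧ ∀ x, ‖SchauderBasis.proj f (l + 1) x‖ + c * ‖x - SchauderBasis.proj f (l + 1) x‖ ≤ ‖x‖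

/-- Families of seminorms, `N ν` being a candidate for the norm of `E_ν`, which agree with the
norm of `F` along branches, are monotone along trees and inherit the splittings of `F`. -/
structure IsBranchFamily (f : SchauderBasis 𝕜 F) (N : List ℕ → Seminorm 𝕜 (List ℕ →₀ 𝕜)) :
    Prop where
  restr_prefixes : ∀ ν v, N ν (restr (prefixes ν) v) = branchNorm f ν v
  single_le : ∀ ν η, N ν (Finsupp.single η 1) ≤ ‖f η.length‖
  restr_le : ∀ T, IsSeqTree T → ∀ ν v, N ν (restr T v) ≤ N ν v
  split : ∀ ν μ c, IsSplitting f ν.length c → ν <+: μ → ∀ v,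
    branchNorm f ν v + c * N μ (v - restr (prefixes ν) v) ≤ N μ v

theorem isBranchFamily_branchNorm (hf : ∀ n, ‖SchauderBasis.proj f n‖ ≤ 1) :
    IsBranchFamily f (branchNorm f) where
  restr_prefixes ν := branchNorm_restr_prefixes f List.prefix_rfl
  single_le := branchNorm_single_le f
  restr_le _ hT := branchNorm_restr_le hf hT
  split ν μ c hc h v := by
    have := hc.2 (lengthMap f (restr (prefixes μ) v))
    rwa [proj_lengthMap_restr_prefixes f h, ← map_sub,
      ← restr_restr_of_subset (prefixes_subset_prefixes h), restr_comm, ← map_sub,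
      restr_comm, restr_restr_of_subset (prefixes_subset_prefixes h)] at this

namespace IsBranchFamily

theorem restr_prefixes_of_prefix (hN : IsBranchFamily f N) (h : ν <+: μ) (v : List ℕ →₀ 𝕜) :
    N μ (restr (prefixes ν) v) = branchNorm f ν v := by
  rw [← restr_restr_of_superset (prefixes_subset_prefixes h), hN.restr_prefixes,
    branchNorm_restr_prefixes f h]

theorem branchNorm_le (hN : IsBranchFamily f N) (h : ν <+: μ) (v : List ℕ →₀ 𝕜) :
    branchNorm f ν v ≤ N μ v :=
  (hN.restr_prefixes_of_prefix h v).ge.trans (hN.restr_le _ (isSeqTree_prefixes ν) μ v)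

theorem iSup {ι : Type*} [Nonempty ι] {M : ι → List ℕ → Seminorm 𝕜 (List ℕ →₀ 𝕜)}
    (hM : ∀ i, IsBranchFamily f (M i)) : IsBranchFamily f fun ν => ⨆ i, M i ν := by
  have hbdd ν : BddAbove (Set.range fun i => M i ν) :=
    bddAbove_range_of_single_le fun i η => (hM i).single_le ν η
  have hle i ν v : M i ν v ≤ (⨆ i, M i ν) v := le_ciSup (f := fun i => M i ν) (hbdd ν) i v
  have hsup {ν v C} (h : ∀ i, M i ν v ≤ C) : (⨆ i, M i ν) v ≤ C := by
    rw [Seminorm.iSup_apply (hbdd ν)]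
    exact ciSup_le h
  refine ⟨fun ν v => ?_, fun ν η => hsup fun i => (hM i).single_le ν η,
    fun T hT ν v => hsup fun i => ((hM i).restr_le T hT ν v).trans (hle i ν v),
    fun ν μ c hc h v => ?_⟩
  · simp only [Seminorm.iSup_apply (hbdd ν), (hM _).restr_prefixes, ciSup_const]
  · rw [← le_sub_iff_add_le', ← le_div_iff₀' hc.1]
    refine hsup fun i => ?_
    rw [le_div_iff₀' hc.1, le_sub_iff_add_le']
    exact ((hM i).split ν μ c hc h v).trans (hle i μ v)

theorem isGlued_branch (hN : IsBranchFamily f N) {g : StrongDual 𝕜 F} (hg : ‖g‖ ≤ 1)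
    (ν : List ℕ) :
    IsGlued N ν ((g : F →ₗ[𝕜] 𝕜).comp ((lengthMap f).comp (restr (prefixes ν)))) := by
  refine ⟨0, fun _ => _, .zero, fun k v => ?_, fun _ _ => rfl, fun k v => ?_, fun v => ?_⟩
  · have h : ‖g (lengthMap f (restr (prefixes ν) v))‖ ≤ branchNorm f ν v := by
      simpa [branchNorm_apply] using g.le_of_opNorm_le hg (lengthMap f (restr (prefixes ν) v))
    exact h.trans (hN.branchNorm_le (List.prefix_append _ _) v)
  · simp [restr_restr_of_disjoint (disjoint_prefixes_cone_concat ν k)]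
  · simp [restr_restr_of_subset (prefixes_subset_comparable ν)]

theorem isGlued_split (hN : IsBranchFamily f N) (hc : IsSplitting f ν.length c) (h : ν <+: μ)
    {g : StrongDual 𝕜 F} (hg : ‖g‖ ≤ 1) (hφ : IsGlued N μ φ) :
    IsGlued N μ ((g : F →ₗ[𝕜] 𝕜).comp ((lengthMap f).comp (restr (prefixes ν))) +
      (c : 𝕜) • φ.comp (LinearMap.id - restr (prefixes ν))) := by
  obtain ⟨α, ψ, hψ⟩ := hφ
  have hcone k (v : List ℕ →₀ 𝕜) : restr (prefixes ν) (restr (cone (μ ++ [k])) v) = 0 :=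
    restr_restr_of_disjoint
      ((disjoint_prefixes_cone_concat μ k).mono_left (prefixes_subset_prefixes h)) v
  have hcomp (v : List ℕ →₀ 𝕜) :
      restr (prefixes ν) (restr (comparable μ) v) = restr (prefixes ν) v :=
    restr_restr_of_subset ((prefixes_subset_prefixes h).trans (prefixes_subset_comparable μ)) v
  refine ⟨α, fun k => (g : F →ₗ[𝕜] 𝕜).comp ((lengthMap f).comp (restr (prefixes ν))) +
      (c : 𝕜) • (ψ k).comp (LinearMap.id - restr (prefixes ν)), hψ.weight, fun k v => ?_,
    fun k v => ?_, fun k v => ?_, fun v => ?_⟩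
  · refine (norm_add_le _ _).trans (le_trans (add_le_add ?_ ?_)
      (hN.split ν (μ ++ [k]) c hc (h.trans (List.prefix_append _ _)) v))
    · simpa [branchNorm_apply] using g.le_of_opNorm_le hg (lengthMap f (restr (prefixes ν) v))
    · rw [LinearMap.smul_apply, norm_smul, RCLike.norm_ofReal, abs_of_pos hc.1]
      exact mul_le_mul_of_nonneg_left (hψ.norm_le k _) hc.1.le
  · simp only [LinearMap.add_apply, LinearMap.smul_apply, LinearMap.comp_apply,
      LinearMap.sub_apply, LinearMap.id_apply, restr_comm (prefixes ν) (prefixes μ), ← map_sub,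
      hψ.map_restr_prefixes k]
  · simp only [LinearMap.add_apply, LinearMap.smul_apply, LinearMap.comp_apply,
      LinearMap.sub_apply, LinearMap.id_apply, hcone, sub_zero, map_zero, zero_add,
      hψ.map_restr_cone, smul_eq_mul]
    exact mul_left_comm _ _ _
  · have := hψ.map_restr_comparable (v - restr (prefixes ν) v)
    rw [map_sub, restr_comm, hcomp] at this
    simp only [LinearMap.add_apply, LinearMap.smul_apply, LinearMap.comp_apply,
      LinearMap.sub_apply, LinearMap.id_apply, hcomp, this]

theorem glueNorm_restr_prefixes (hN : IsBranchFamily f N) (ν : List ℕ) (v : List ℕ →₀ 𝕜) :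
    glueNorm N ν (restr (prefixes ν) v) = branchNorm f ν v := by
  refine le_antisymm (glueNorm_le hN.single_le fun φ ⟨α, ψ, hψ⟩ => ?_) ?_
  · rw [hψ.map_restr_prefixes 0, ← hN.restr_prefixes_of_prefix (List.prefix_append ν [0])]
    exact hψ.norm_le 0 _
  · obtain ⟨g, hg, hgv⟩ := exists_dual_vector'' 𝕜 (lengthMap f (restr (prefixes ν) v))
    have := (hN.isGlued_branch hg ν).norm_apply_le_glueNorm hN.single_le (restr (prefixes ν) v)
    simpa [restr_restr_self, hgv, branchNorm_apply] using this

theorem glueNorm_split (hN : IsBranchFamily f N) (hc : IsSplitting f ν.length c) (h : ν <+: μ)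
    (v : List ℕ →₀ 𝕜) :
    branchNorm f ν v + c * glueNorm N μ (v - restr (prefixes ν) v) ≤ glueNorm N μ v := by
  rw [← le_sub_iff_add_le', ← le_div_iff₀' hc.1]
  refine glueNorm_le hN.single_le fun φ hφ => ?_
  rw [le_div_iff₀' hc.1, le_sub_iff_add_le']
  obtain ⟨θ, hθ, hθφ⟩ := RCLike.exists_norm_eq_mul_self (φ (v - restr (prefixes ν) v))
  obtain ⟨g, hg, hgv⟩ := exists_dual_vector'' 𝕜 (lengthMap f (restr (prefixes ν) v))
  have key := (hN.isGlued_split hc h hg (hφ.smul hθ.le)).norm_apply_le_glueNorm hN.single_le v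
  change ‖g (lengthMap f (restr (prefixes ν) v)) + c * (θ * φ (v - restr (prefixes ν) v))‖ ≤ _
    at key
  rwa [← hθφ, hgv, ← branchNorm_apply, ← RCLike.ofReal_mul, ← RCLike.ofReal_add,
    RCLike.norm_of_nonneg (add_nonneg (apply_nonneg _ _)
      (mul_nonneg hc.1.le (norm_nonneg _)))] at key

theorem isBranchFamily_glueNorm (hN : IsBranchFamily f N) : IsBranchFamily f (glueNorm N) where
  restr_prefixes := hN.glueNorm_restr_prefixes
  single_le := glueNorm_single_le hN.single_le
  restr_le T hT := glueNorm_restr_le hN.single_le (hN.restr_le T hT)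
  split _ _ _ hc h := hN.glueNorm_split hc h

end IsBranchFamily

/-- The largest branch family below its own gluing. -/
noncomputable def treeNorm (f : SchauderBasis 𝕜 F) (ν : List ℕ) : Seminorm 𝕜 (List ℕ →₀ 𝕜) :=
  ⨆ M : {M // IsBranchFamily f M ∧ ∀ ν, M ν ≤ glueNorm M ν}, M.1 ν

theorem branchNorm_le_glueNorm_branchNorm (hf : ∀ n, ‖SchauderBasis.proj f n‖ ≤ 1) (ν : List ℕ) :
    branchNorm f ν ≤ glueNorm (branchNorm f) ν :=
  (isBranchFamily_branchNorm hf).isBranchFamily_glueNorm.branchNorm_le List.prefix_rfl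

theorem isBranchFamily_treeNorm (hf : ∀ n, ‖SchauderBasis.proj f n‖ ≤ 1) :
    IsBranchFamily f (treeNorm f) :=
  have : Nonempty {M // IsBranchFamily f M ∧ ∀ ν, M ν ≤ glueNorm M ν} :=
    ⟨⟨_, isBranchFamily_branchNorm hf, branchNorm_le_glueNorm_branchNorm hf⟩⟩
  .iSup fun M => M.2.1

theorem le_treeNorm (hN : IsBranchFamily f N) (h : ∀ ν, N ν ≤ glueNorm N ν) (ν : List ℕ) :
    N ν ≤ treeNorm f ν :=
  le_ciSup (f := fun M : {M // IsBranchFamily f M ∧ ∀ ν, M ν ≤ glueNorm M ν} => M.1 ν)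
    (bddAbove_range_of_single_le fun M η => M.2.1.single_le ν η) ⟨N, hN, h⟩

/- Knaster–Tarski: the supremum of all families below their gluing is below its gluing, and then
its gluing takes part in the supremum. -/
theorem glueNorm_treeNorm (hf : ∀ n, ‖SchauderBasis.proj f n‖ ≤ 1) :
    glueNorm (treeNorm f) = treeNorm f := by
  have htree := isBranchFamily_treeNorm hf
  have hle ν : treeNorm f ν ≤ glueNorm (treeNorm f) ν :=
    have : Nonempty {M // IsBranchFamily f M ∧ ∀ ν, M ν ≤ glueNorm M ν} :=
      ⟨⟨_, isBranchFamily_branchNorm hf, branchNorm_le_glueNorm_branchNorm hf⟩⟩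
    ciSup_le (f := fun M : {M // IsBranchFamily f M ∧ ∀ ν, M ν ≤ glueNorm M ν} => M.1 ν)
      fun M => (M.2.2 ν).trans <|
        glueNorm_mono M.2.1.single_le htree.single_le (le_treeNorm M.2.1 M.2.2) ν
  have hle' := glueNorm_mono htree.single_le htree.isBranchFamily_glueNorm.single_le hle
  exact funext fun ν => le_antisymm (le_treeNorm htree.isBranchFamily_glueNorm hle' ν) (hle ν)

end TreeNorm

section Consistency

variable {𝕜 : Type*} [RCLike 𝕜] {F : Type*} [NormedAddCommGroup F] [NormedSpace 𝕜 F]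
  {f : SchauderBasis 𝕜 F} {N : List ℕ → Seminorm 𝕜 (List ℕ →₀ 𝕜)} {ν : List ℕ} {k : ℕ}
  {α : ℕ → ℝ} {ψ : ℕ → (List ℕ →₀ 𝕜) →ₗ[𝕜] 𝕜} {φ : (List ℕ →₀ 𝕜) →ₗ[𝕜] 𝕜}

theorem restr_comparable_concat (ν : List ℕ) (k : ℕ) (v : List ℕ →₀ 𝕜) :
    restr (comparable (ν ++ [k])) v = restr (prefixes ν) v + restr (cone (ν ++ [k])) v := by
  rw [comparable_concat, restr_union (disjoint_prefixes_cone_concat ν k)]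

theorem IsGluing.map_restr_comparable_concat (hφ : IsGluing N ν α ψ φ) (k : ℕ)
    (v : List ℕ →₀ 𝕜) :
    φ (restr (comparable (ν ++ [k])) v) = ((1 - α k : ℝ) : 𝕜) * ψ k (restr (prefixes ν) v) +
      α k * ψ k (restr (comparable (ν ++ [k])) v) := by
  rw [restr_comparable_concat, map_add, map_add, hφ.map_restr_prefixes k, hφ.map_restr_cone,
    RCLike.ofReal_sub, RCLike.ofReal_one]
  ring

namespace IsBranchFamily

theorem glueNorm_restr_comparable_concat_le (hN : IsBranchFamily f N) (ν : List ℕ) (k : ℕ)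
    (v : List ℕ →₀ 𝕜) : glueNorm N ν (restr (comparable (ν ++ [k])) v) ≤ N (ν ++ [k]) v := by
  refine glueNorm_le hN.single_le fun φ ⟨α, ψ, hψ⟩ => ?_
  have hψ_le {T : Set (List ℕ)} (hT : IsSeqTree T) : ‖ψ k (restr T v)‖ ≤ N (ν ++ [k]) v :=
    (hψ.norm_le k _).trans (hN.restr_le T hT _ v)
  have h0 := hψ.weight.nonneg k
  have h1 := sub_nonneg.2 (hψ.weight.le_one k)
  calc ‖φ (restr (comparable (ν ++ [k])) v)‖
      ≤ (1 - α k) * ‖ψ k (restr (prefixes ν) v)‖ +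
          α k * ‖ψ k (restr (comparable (ν ++ [k])) v)‖ := by
        rw [hψ.map_restr_comparable_concat]
        refine (norm_add_le _ _).trans_eq ?_
        rw [norm_mul, norm_mul, RCLike.norm_of_nonneg h0, RCLike.norm_of_nonneg h1]
    _ ≤ (1 - α k) * N (ν ++ [k]) v + α k * N (ν ++ [k]) v :=
        add_le_add (mul_le_mul_of_nonneg_left (hψ_le (isSeqTree_prefixes ν)) h1)
          (mul_le_mul_of_nonneg_left (hψ_le (isSeqTree_comparable _)) h0)
    _ = N (ν ++ [k]) v := by ring

theorem isGlued_comp_restr_comparable_concat (hN : IsBranchFamily f N)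
    (hφ : ∀ v, ‖φ v‖ ≤ N (ν ++ [k]) v) :
    IsGlued N ν (φ.comp (restr (comparable (ν ++ [k])))) := by
  have hpre (v : List ℕ →₀ 𝕜) : restr (comparable (ν ++ [k])) (restr (prefixes ν) v) =
      restr (prefixes ν) v :=
    restr_restr_of_superset (by simp [comparable_concat]) v
  refine ⟨Pi.single k 1, Function.update (fun _ => φ.comp (restr (prefixes ν))) k φ, .single k,
    fun j v => ?_, fun j v => ?_, fun j v => ?_, fun v => ?_⟩
  · rcases eq_or_ne j k with rfl | hj
    · simpa using hφ v
    · rw [Function.update_of_ne hj]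
      refine (hφ _).trans ?_
      rw [hN.restr_prefixes_of_prefix (List.prefix_append _ _)]
      exact hN.branchNorm_le (List.prefix_append _ _) v
  · rcases eq_or_ne j k with rfl | hj
    · simp [hpre]
    · simp [hj, hpre, restr_restr_self]
  · rcases eq_or_ne j k with rfl | hj
    · simp [restr_comparable_concat, restr_restr_of_disjoint (disjoint_prefixes_cone_concat ν j),
        restr_restr_self]
    · simp [hj, restr_comparable_concat,
        restr_restr_of_disjoint (disjoint_prefixes_cone_concat ν j),
        restr_restr_of_disjoint (disjoint_cone_concat ν hj.symm)]
  · simp [restr_restr_of_subset (comparable_concat_subset ν k)]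

theorem restr_comparable_concat_of_glueNorm_eq (hN : IsBranchFamily f N)
    (hfix : glueNorm N = N) (ν : List ℕ) (k : ℕ) (v : List ℕ →₀ 𝕜) :
    N ν (restr (comparable (ν ++ [k])) v) = N (ν ++ [k]) v := by
  have hle {μ φ} (hφ : IsGlued N μ φ) (w : List ℕ →₀ 𝕜) : ‖φ w‖ ≤ N μ w := by
    simpa only [hfix] using hφ.norm_apply_le_glueNorm hN.single_le w
  refine le_antisymm ?_ ?_
  · simpa only [hfix] using hN.glueNorm_restr_comparable_concat_le ν k v
  · rw [← congrFun hfix (ν ++ [k])]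
    refine glueNorm_le hN.single_le fun φ hφ => ?_
    have := hle (hN.isGlued_comp_restr_comparable_concat (hle hφ))
      (restr (comparable (ν ++ [k])) v)
    obtain ⟨_, _, hψ⟩ := hφ
    rwa [LinearMap.comp_apply, restr_restr_self, hψ.map_restr_comparable] at this

theorem nil_restr_comparable_of_glueNorm_eq (hN : IsBranchFamily f N) (hfix : glueNorm N = N)
    (ν : List ℕ) (v : List ℕ →₀ 𝕜) : N [] (restr (comparable ν) v) = N ν v := by
  induction ν using List.reverseRecOn generalizing v with
  | nil => rw [comparable_nil, restr_univ]
  | append_singleton ν k ih =>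
    rw [← hN.restr_comparable_concat_of_glueNorm_eq hfix, ← ih,
      restr_restr_of_superset (comparable_concat_subset ν k)]

end IsBranchFamily

end Consistency

section ClosedSpan

variable {𝕜 : Type*} [RCLike 𝕜] {E : Type*} [NormedAddCommGroup E] [NormedSpace 𝕜 E]
  {e : List ℕ → E} {S T : Set (List ℕ)}

theorem closedSpan_mono (e : List ℕ → E) (h : S ⊆ T) :
    closedSpan (𝕜 := 𝕜) e S ≤ closedSpan e T :=
  Submodule.topologicalClosure_mono (Submodule.span_mono (Set.image_mono h))

theorem isClosed_closedSpan (e : List ℕ → E) (S : Set (List ℕ)) :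
    IsClosed (closedSpan (𝕜 := 𝕜) e S : Set E) :=
  Submodule.isClosed_topologicalClosure _

theorem linearCombination_restr_mem_closedSpan (e : List ℕ → E) (S : Set (List ℕ))
    (v : List ℕ →₀ 𝕜) : Finsupp.linearCombination 𝕜 e (restr S v) ∈ closedSpan (𝕜 := 𝕜) e S := by
  refine Submodule.le_topologicalClosure _
    (Finsupp.mem_span_image_iff_linearCombination 𝕜 |>.2 ⟨_, ?_, rfl⟩)
  refine (Finsupp.mem_supported' 𝕜 _).2 fun η hη => ?_
  rw [restr_apply, Set.indicator_of_notMem hη]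

theorem closedSpan_induction {p : E → Prop} (hp : IsClosed {x | p x})
    (h : ∀ v : List ℕ →₀ 𝕜, p (Finsupp.linearCombination 𝕜 e (restr S v))) {x : E}
    (hx : x ∈ closedSpan (𝕜 := 𝕜) e S) : p x := by
  refine hp.closure_subset_iff.2 ?_ hx
  intro y hy
  obtain ⟨v, hv, rfl⟩ := (Finsupp.mem_span_image_iff_linearCombination 𝕜).1 hy
  have := h v
  rwa [restr_of_support_subset ((Finsupp.mem_supported 𝕜 v).1 hv)] at this

theorem topologicalClosure_closedSpan_sup_iSup (e : List ℕ → E) (S : Set (List ℕ))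
    (T : ℕ → Set (List ℕ)) :
    (closedSpan (𝕜 := 𝕜) e S ⊔ ⨆ k, closedSpan e (T k)).topologicalClosure =
      closedSpan e (S ∪ ⋃ k, T k) := by
  refine le_antisymm (Submodule.topologicalClosure_minimal _ (sup_le ?_ (iSup_le fun k => ?_))
    (isClosed_closedSpan _ _)) (Submodule.topologicalClosure_mono ?_)
  · exact closedSpan_mono e Set.subset_union_left
  · exact closedSpan_mono e ((Set.subset_iUnion T k).trans Set.subset_union_right)
  · rw [Set.image_union, Submodule.span_union, Set.image_iUnion, Submodule.span_iUnion]
    exact sup_le_sup (Submodule.le_topologicalClosure _)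
      (iSup_mono fun k => Submodule.le_topologicalClosure _)

/-- `P` is the projection `∑ r η • e η ↦ ∑ η ∈ S, r η • e η` onto the coordinates in `S`. Only its
values on finite sums are prescribed; they determine it when the `e η` span a dense subspace. -/
def IsCoordProj (e : List ℕ → E) (S : Set (List ℕ)) (P : E →L[𝕜] E) : Prop :=
  ∀ v : List ℕ →₀ 𝕜,
    P (Finsupp.linearCombination 𝕜 e v) = Finsupp.linearCombination 𝕜 e (restr S v)

namespace IsCoordProj

variable {P Q : E →L[𝕜] E} {x : E}

theorem add (hP : IsCoordProj e S P) (hQ : IsCoordProj e T Q) (hST : Disjoint S T) :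
    IsCoordProj e (S ∪ T) (P + Q) := fun v => by
  rw [add_apply, hP, hQ, restr_union hST, map_add]

theorem sub (hP : IsCoordProj e S P) (hQ : IsCoordProj e T Q) (hST : S ⊆ T) :
    IsCoordProj e (T \ S) (Q - P) := fun v => by
  rw [sub_apply, hP, hQ, restr_diff hST, map_sub]

theorem apply_eq_self (hP : IsCoordProj e S P) (hx : x ∈ closedSpan (𝕜 := 𝕜) e S) : P x = x :=
  closedSpan_induction (isClosed_eq P.continuous continuous_id')
    (fun v => by rw [hP, restr_restr_self]) hx

theorem apply_eq_zero (hP : IsCoordProj e S P) (hST : Disjoint S T)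
    (hx : x ∈ closedSpan (𝕜 := 𝕜) e T) : P x = 0 :=
  closedSpan_induction (isClosed_eq P.continuous continuous_const)
    (fun v => by rw [hP, restr_restr_of_disjoint hST, map_zero]) hx

theorem apply_mem (hP : IsCoordProj e S P)
    (hdense : DenseRange (Finsupp.linearCombination 𝕜 e)) (x : E) :
    P x ∈ closedSpan (𝕜 := 𝕜) e S :=
  hdense.induction_on x ((isClosed_closedSpan e S).preimage P.continuous) fun v => by
    rw [hP]
    exact linearCombination_restr_mem_closedSpan e S v

/-- A coordinate projection as a map onto the closed span of its coordinates. -/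
noncomputable def toClosedSpan (hP : IsCoordProj e S P)
    (hdense : DenseRange (Finsupp.linearCombination 𝕜 e)) : E →L[𝕜] closedSpan (𝕜 := 𝕜) e S :=
  P.codRestrict _ (hP.apply_mem hdense)

theorem coe_toClosedSpan (hP : IsCoordProj e S P)
    (hdense : DenseRange (Finsupp.linearCombination 𝕜 e)) (x : E) :
    (hP.toClosedSpan hdense x : E) = P x := rfl

theorem toClosedSpan_linearCombination_restr (hP : IsCoordProj e S P)
    (hdense : DenseRange (Finsupp.linearCombination 𝕜 e)) (v : List ℕ →₀ 𝕜) :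
    hP.toClosedSpan hdense (Finsupp.linearCombination 𝕜 e (restr S v)) =
      hP.toClosedSpan hdense (Finsupp.linearCombination 𝕜 e v) :=
  Subtype.ext <| by rw [coe_toClosedSpan, coe_toClosedSpan, hP, hP, restr_restr_self]

theorem closedSpan_union (hP : IsCoordProj e S P) (hQ : IsCoordProj e T Q)
    (hdense : DenseRange (Finsupp.linearCombination 𝕜 e)) (hST : Disjoint S T) :
    closedSpan (𝕜 := 𝕜) e (S ∪ T) = closedSpan e S ⊔ closedSpan e T := by
  refine le_antisymm (fun x hx => ?_) (sup_le (closedSpan_mono e Set.subset_union_left)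
    (closedSpan_mono e Set.subset_union_right))
  rw [← (hP.add hQ hST).apply_eq_self hx]
  exact Submodule.add_mem_sup (hP.apply_mem hdense x) (hQ.apply_mem hdense x)

end IsCoordProj

end ClosedSpan

section MonotoneTreeSystem

theorem eventually_subset_finiteTree (A : Finset (List ℕ)) :
    ∀ᶠ T in (atTop : Filter {T : Finset (List ℕ) // IsSeqTree (T : Set (List ℕ))}), A ⊆ T.1 := by
  refine (Finset.eventually_all A).2 fun η _ => ?_
  have hη : IsSeqTree (η.inits.toFinset : Set (List ℕ)) := by
    simpa [prefixes] using isSeqTree_prefixes η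
  have : Nonempty {T : Finset (List ℕ) // IsSeqTree (T : Set (List ℕ))} := ⟨⟨_, hη⟩⟩
  filter_upwards [eventually_ge_atTop ⟨_, hη⟩] with T hT
  exact hT (by simp)

variable {𝕜 : Type*} [RCLike 𝕜] {E : Type*} [NormedAddCommGroup E] [NormedSpace 𝕜 E]
  {e : List ℕ → E} {T : Set (List ℕ)}

variable (𝕜 e) in
/-- A system of nonzero vectors with dense linear span whose restrictions to trees do not increase
the norm of finite sums. In a Banach space, such a system is a basis with respect to summation over
finite trees. -/
structure IsMonotoneTreeSystem : Prop where
  ne_zero : ∀ η, e η ≠ 0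
  denseRange : DenseRange (Finsupp.linearCombination 𝕜 e)
  norm_restr_le : ∀ T, IsSeqTree T → ∀ v : List ℕ →₀ 𝕜,
    ‖Finsupp.linearCombination 𝕜 e (restr T v)‖ ≤ ‖Finsupp.linearCombination 𝕜 e v‖

variable (𝕜 e) in
/-- The extension by continuity of the coefficient of `e η`. For a monotone tree system this is the
coordinate functional; without the bound on finite sums it is a junk value. -/
noncomputable def treeCoord (η : List ℕ) : StrongDual 𝕜 E :=
  (Finsupp.lapply η : (List ℕ →₀ 𝕜) →ₗ[𝕜] 𝕜).extendOfNorm (Finsupp.linearCombination 𝕜 e)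

variable (𝕜 e) [CompleteSpace E] in
/-- The projection `P_T`, extended by continuity from finite sums. It is meaningful for trees `T`
and monotone tree systems `e`. -/
noncomputable def treeProj (T : Set (List ℕ)) : E →L[𝕜] E :=
  (Finsupp.linearCombination 𝕜 e ∘ₗ restr T).extendOfNorm (Finsupp.linearCombination 𝕜 e)

namespace IsMonotoneTreeSystem

variable (he : IsMonotoneTreeSystem 𝕜 e)
include he

theorem norm_apply_mul_norm_le (v : List ℕ →₀ 𝕜) (η : List ℕ) :
    ‖v η‖ * ‖e η‖ ≤ 2 * ‖Finsupp.linearCombination 𝕜 e v‖ := by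
  have hη : {η} ⊆ prefixes η := Set.singleton_subset_iff.2 List.prefix_rfl
  have htree : IsSeqTree (prefixes η \ {η}) := fun μ ν hμ hν =>
    ⟨hμ.trans hν.1, fun h : μ = η => hν.2 (hν.1.eq_of_length_le (h ▸ hμ.length_le))⟩
  have hrestr : restr (prefixes η) v - restr (prefixes η \ {η}) v = Finsupp.single η (v η) := by
    rw [restr_diff hη, sub_sub_cancel]
    simpa using restr_finset {η} v
  calc ‖v η‖ * ‖e η‖
      = ‖Finsupp.linearCombination 𝕜 e (restr (prefixes η) v) -
          Finsupp.linearCombination 𝕜 e (restr (prefixes η \ {η}) v)‖ := by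
        rw [← map_sub, hrestr, Finsupp.linearCombination_single, norm_smul]
    _ ≤ 2 * ‖Finsupp.linearCombination 𝕜 e v‖ := by
        rw [two_mul]
        exact (norm_sub_le _ _).trans (add_le_add
          (he.norm_restr_le _ (isSeqTree_prefixes η) v) (he.norm_restr_le _ htree v))

theorem treeCoord_linearCombination (η : List ℕ) (v : List ℕ →₀ 𝕜) :
    treeCoord 𝕜 e η (Finsupp.linearCombination 𝕜 e v) = v η := by
  refine LinearMap.extendOfNorm_eq he.denseRange ⟨2 / ‖e η‖, fun v => ?_⟩ v
  rw [div_mul_eq_mul_div, le_div_iff₀ (norm_pos_iff.2 (he.ne_zero η))]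
  exact he.norm_apply_mul_norm_le v η

theorem treeCoord_apply_of_isCoordProj {P : E →L[𝕜] E} (hP : IsCoordProj e T P) (η : List ℕ)
    (x : E) : treeCoord 𝕜 e η (P x) = T.indicator (fun η => treeCoord 𝕜 e η x) η := by
  refine he.denseRange.induction_on x (isClosed_eq (by fun_prop) ?_) fun v => ?_
  · by_cases hη : η ∈ T
    · simpa only [Set.indicator_of_mem hη] using (treeCoord 𝕜 e η).continuous
    · simpa only [Set.indicator_of_notMem hη] using continuous_const
  · rw [hP, he.treeCoord_linearCombination, restr_apply]
    simp only [he.treeCoord_linearCombination]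

variable [CompleteSpace E]

theorem isCoordProj_treeProj (hT : IsSeqTree T) : IsCoordProj e T (treeProj 𝕜 e T) :=
  LinearMap.extendOfNorm_eq he.denseRange
    ⟨1, fun v => by simpa using he.norm_restr_le T hT v⟩

theorem norm_treeProj_apply_le (hT : IsSeqTree T) (x : E) : ‖treeProj 𝕜 e T x‖ ≤ ‖x‖ := by
  have hbound (v : List ℕ →₀ 𝕜) : ‖(Finsupp.linearCombination 𝕜 e ∘ₗ restr T) v‖ ≤
      1 * ‖Finsupp.linearCombination 𝕜 e v‖ := by
    simpa using he.norm_restr_le T hT v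
  exact (LinearMap.norm_extendOfNorm_apply_le he.denseRange 1 hbound x).trans_eq (one_mul _)

theorem sum_treeCoord_smul {A : Finset (List ℕ)} (hA : IsSeqTree (A : Set (List ℕ))) (x : E) :
    ∑ η ∈ A, treeCoord 𝕜 e η x • e η = treeProj 𝕜 e A x := by
  refine he.denseRange.induction_on x (isClosed_eq (by fun_prop) (by fun_prop)) fun v => ?_
  rw [he.isCoordProj_treeProj hA, restr_finset, map_sum]
  simp only [he.treeCoord_linearCombination, Finsupp.linearCombination_single]

theorem tendsto_treeProj (x : E) :
    Tendsto (fun A : {T : Finset (List ℕ) // IsSeqTree (T : Set (List ℕ))} => treeProj 𝕜 e A.1 x)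
      atTop (𝓝 x) := by
  refine Metric.tendsto_nhds.2 fun ε hε => ?_
  obtain ⟨v, hv⟩ := he.denseRange.exists_dist_lt x (half_pos hε)
  filter_upwards [eventually_subset_finiteTree v.support] with A hA
  have hfix : treeProj 𝕜 e A.1 (Finsupp.linearCombination 𝕜 e v) =
      Finsupp.linearCombination 𝕜 e v := by
    rw [he.isCoordProj_treeProj A.2, restr_of_support_subset (Finset.coe_subset.2 hA)]
  have hdist := he.norm_treeProj_apply_le A.2 (x - Finsupp.linearCombination 𝕜 e v)
  rw [map_sub, hfix, ← dist_eq_norm, ← dist_eq_norm] at hdist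
  linarith [dist_triangle_right (treeProj 𝕜 e A.1 x) x (Finsupp.linearCombination 𝕜 e v)]

theorem hasSum_treeCoord_smul (x : E) :
    HasSum (fun η => treeCoord 𝕜 e η x • e η) x finiteTrees := by
  rw [HasSum, finiteTrees, tendsto_map'_iff]
  exact (he.tendsto_treeProj x).congr fun A => (he.sum_treeCoord_smul A.2 x).symm

theorem hasSum_indicator_treeCoord_smul {P : E →L[𝕜] E} (hP : IsCoordProj e T P) (x : E) :
    HasSum (T.indicator fun η => treeCoord 𝕜 e η x • e η) (P x) finiteTrees := by
  convert he.hasSum_treeCoord_smul (P x) using 2 with η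
  rw [he.treeCoord_apply_of_isCoordProj hP, Set.indicator_smul_apply_left]

/-- The basis formed by a monotone tree system. -/
noncomputable def basis : GeneralSchauderBasis (List ℕ) 𝕜 E finiteTrees where
  basis := e
  coord := treeCoord 𝕜 e
  ortho η ν := by
    convert he.treeCoord_linearCombination η (Finsupp.single ν 1) using 1
    · rw [Finsupp.linearCombination_single, one_smul]
    · simp [Finsupp.single_apply, Pi.single_apply, eq_comm]
  expansion := he.hasSum_treeCoord_smul

end IsMonotoneTreeSystem

end MonotoneTreeSystem

section NodeSum

variable {𝕜 : Type*} [RCLike 𝕜] {E : Type*} [NormedAddCommGroup E] [NormedSpace 𝕜 E]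
  {e : List ℕ → E} {ν : List ℕ} {α : ℕ → ℝ} {φ : (List ℕ →₀ 𝕜) →ₗ[𝕜] 𝕜}
  {ψ : ℕ → (List ℕ →₀ 𝕜) →ₗ[𝕜] 𝕜}

variable (𝕜 e) in
/-- The norm of `E` on the finite sums `∑ r η • e η` over the `η` comparable with `ν`, as a
seminorm of the coefficients. -/
noncomputable def localNorm (ν : List ℕ) : Seminorm 𝕜 (List ℕ →₀ 𝕜) :=
  (normSeminorm 𝕜 E).comp (Finsupp.linearCombination 𝕜 e ∘ₗ restr (comparable ν))

theorem localNorm_apply (ν : List ℕ) (v : List ℕ →₀ 𝕜) :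
    localNorm 𝕜 e ν v = ‖Finsupp.linearCombination 𝕜 e (restr (comparable ν) v)‖ := rfl

theorem IsMonotoneTreeSystem.localNorm_le (he : IsMonotoneTreeSystem 𝕜 e) (ν : List ℕ)
    (v : List ℕ →₀ 𝕜) : localNorm 𝕜 e ν v ≤ ‖Finsupp.linearCombination 𝕜 e v‖ :=
  he.norm_restr_le _ (isSeqTree_comparable ν) v

theorem IsMonotoneTreeSystem.localNorm_single_le (he : IsMonotoneTreeSystem 𝕜 e)
    (ν η : List ℕ) : localNorm 𝕜 e ν (Finsupp.single η 1) ≤ ‖e η‖ := by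
  simpa using he.localNorm_le ν (Finsupp.single η 1)

/-- The part of `v` supported on the initial segments of `ν` and on the extensions of the
`ν ++ [k]` with `k ∈ K`. -/
noncomputable def nodePart (ν : List ℕ) (K : Finset ℕ) (v : List ℕ →₀ 𝕜) : List ℕ →₀ 𝕜 :=
  restr (prefixes ν) v + ∑ k ∈ K, restr (cone (ν ++ [k])) v

theorem restr_comparable_nodePart (ν : List ℕ) (K : Finset ℕ) (v : List ℕ →₀ 𝕜) :
    restr (comparable ν) (nodePart ν K v) = nodePart ν K v := by
  rw [nodePart, map_add, map_sum, restr_restr_of_superset (prefixes_subset_comparable ν)]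
  simp only [restr_restr_of_superset (cone_concat_subset_comparable ν _)]

theorem restr_prefixes_nodePart (ν : List ℕ) (K : Finset ℕ) (v : List ℕ →₀ 𝕜) :
    restr (prefixes ν) (nodePart ν K v) = restr (prefixes ν) v := by
  rw [nodePart, map_add, map_sum, restr_restr_self, Finset.sum_eq_zero fun k _ =>
    restr_restr_of_disjoint (disjoint_prefixes_cone_concat ν k) v, add_zero]

theorem restr_cone_nodePart {K : Finset ℕ} {k : ℕ} (hk : k ∈ K) (v : List ℕ →₀ 𝕜) :
    restr (cone (ν ++ [k])) (nodePart ν K v) = restr (cone (ν ++ [k])) v := by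
  rw [nodePart, map_add, map_sum,
    restr_restr_of_disjoint (disjoint_prefixes_cone_concat ν k).symm, zero_add,
    Finset.sum_eq_single_of_mem k hk fun j _ hjk =>
      restr_restr_of_disjoint (disjoint_cone_concat ν hjk.symm) v, restr_restr_self]

theorem IsGluing.map_nodePart {N : List ℕ → Seminorm 𝕜 (List ℕ →₀ 𝕜)}
    (hφ : IsGluing N ν α ψ φ) (K : Finset ℕ) (v : List ℕ →₀ 𝕜) :
    φ (nodePart ν K v) = ψ 0 (restr (prefixes ν) v) +
      ∑ k ∈ K, (α k : 𝕜) * ψ k (restr (cone (ν ++ [k])) v) := by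
  simp only [nodePart, map_add, map_sum, hφ.map_restr_prefixes 0, hφ.map_restr_cone]

theorem tsum_mul_apply_sum_single {Y : ℕ → Type*} [∀ k, NormedAddCommGroup (Y k)]
    [∀ k, NormedSpace 𝕜 (Y k)] (α : ℕ → 𝕜) (y' : ∀ k, StrongDual 𝕜 (Y k)) (K : Finset ℕ)
    (y : ∀ k, Y k) :
    ∑' k, α k * y' k ((∑ j ∈ K, lp.single 2 j (y j) : lp Y 2) k) =
      ∑ k ∈ K, α k * y' k (y k) := by
  have hcoord (k : ℕ) : (∑ j ∈ K, lp.single 2 j (y j) : lp Y 2) k = if k ∈ K then y k else 0 := by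
    rw [lp.coeFn_sum]
    refine (Finset.sum_apply k K _).trans ?_
    simp [Finset.sum_pi_single]
  rw [tsum_eq_sum fun k (hk : k ∉ K) => by rw [hcoord, if_neg hk, map_zero, mul_zero]]
  exact Finset.sum_congr rfl fun k hk => by rw [hcoord, if_pos hk]

theorem isGluing_indicator {N : List ℕ → Seminorm 𝕜 (List ℕ →₀ 𝕜)}
    {ξ : (List ℕ →₀ 𝕜) →ₗ[𝕜] 𝕜} {ζ : ℕ → (List ℕ →₀ 𝕜) →ₗ[𝕜] 𝕜} (hα : IsL2Weight α)
    (hξ : ∀ v, ξ (restr (prefixes ν) v) = ξ v)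
    (hζ : ∀ k v, ζ k (restr (cone (ν ++ [k])) v) = ζ k v)
    (hle : ∀ k v, ‖ξ v + ζ k v‖ ≤ N (ν ++ [k]) v) (K : Finset ℕ) :
    IsGluing N ν ((K : Set ℕ).indicator α) (fun k => ξ + ζ k)
      (ξ + ∑ k ∈ K, (α k : 𝕜) • ζ k) := by
  have hξ_cone (k : ℕ) (v : List ℕ →₀ 𝕜) : ξ (restr (cone (ν ++ [k])) v) = 0 := by
    rw [← hξ, restr_restr_of_disjoint (disjoint_prefixes_cone_concat ν k), map_zero]
  have hζ_prefixes (k : ℕ) (v : List ℕ →₀ 𝕜) : ζ k (restr (prefixes ν) v) = 0 := by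
    rw [← hζ, restr_restr_of_disjoint (disjoint_prefixes_cone_concat ν k).symm, map_zero]
  have hζ_cone {j k : ℕ} (hjk : j ≠ k) (v : List ℕ →₀ 𝕜) :
      ζ j (restr (cone (ν ++ [k])) v) = 0 := by
    rw [← hζ, restr_restr_of_disjoint (disjoint_cone_concat ν hjk), map_zero]
  refine ⟨hα.mono (Set.indicator_nonneg fun k _ => hα.nonneg k)
    (Set.indicator_le_self' fun k _ => hα.nonneg k), hle, fun k v => ?_, fun k v => ?_,
    fun v => ?_⟩
  · simp [hζ_prefixes]
  · rw [LinearMap.add_apply, LinearMap.sum_apply, hξ_cone, zero_add, LinearMap.add_apply, hξ_cone,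
      zero_add]
    by_cases hk : k ∈ K
    · rw [Finset.sum_eq_single_of_mem k hk fun j _ hjk => by simp [hζ_cone hjk]]
      simp [hk, RCLike.real_smul_eq_coe_mul]
    · rw [Finset.sum_eq_zero fun j hj => by simp [hζ_cone (ne_of_mem_of_not_mem hj hk)]]
      simp [hk]
  · have hξ_comparable : ξ (restr (comparable ν) v) = ξ v := by
      rw [← hξ, restr_restr_of_subset (prefixes_subset_comparable ν), hξ]
    have hζ_comparable (k : ℕ) : ζ k (restr (comparable ν) v) = ζ k v := by
      rw [← hζ, restr_restr_of_subset (cone_concat_subset_comparable ν k), hζ]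
    simp [hξ_comparable, hζ_comparable]

variable {P : E →L[𝕜] E} {Q : ℕ → E →L[𝕜] E} (he : IsMonotoneTreeSystem 𝕜 e)
  (hP : IsCoordProj e (prefixes ν) P) (hQ : ∀ k, IsCoordProj e (cone (ν ++ [k])) (Q k))

/-- The vector `P w + ∑ k ∈ K, Q k w` of `E`, as a formal sum. -/
noncomputable def nodeDecomp (K : Finset ℕ) (w : E) :
    GenSum (closedSpan (𝕜 := 𝕜) e (prefixes ν))
      (fun k => closedSpan (𝕜 := 𝕜) e (cone (ν ++ [k]))) :=
  (hP.toClosedSpan he.denseRange w,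
    ∑ k ∈ K, lp.single 2 k ((hQ k).toClosedSpan he.denseRange w))

theorem continuous_nodeDecomp (K : Finset ℕ) : Continuous (nodeDecomp he hP hQ K) := by
  refine (ContinuousLinearMap.continuous _).prodMk (continuous_finsetSum _ fun k _ => ?_)
  exact (lp.isometry_single k).continuous.comp (ContinuousLinearMap.continuous _)

theorem exists_mem_genLambda_of_isGluing (hφ : IsGluing (localNorm 𝕜 e) ν α ψ φ) :
    ∃ Φ ∈ genLambda (𝕜 := 𝕜) fun k =>
        ambientNorm (closedSpan (𝕜 := 𝕜) e (prefixes ν)) (closedSpan e (cone (ν ++ [k]))),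
      ∀ K v, Φ (nodeDecomp he hP hQ K (Finsupp.linearCombination 𝕜 e v)) =
        φ (nodePart ν K v) := by
  have hbound (k : ℕ) (v : List ℕ →₀ 𝕜) : ‖ψ k v‖ ≤ 1 * ‖Finsupp.linearCombination 𝕜 e v‖ := by
    rw [one_mul]
    exact (hφ.norm_le k v).trans (he.localNorm_le _ v)
  let ψ' (k : ℕ) : StrongDual 𝕜 E := (ψ k).extendOfNorm (Finsupp.linearCombination 𝕜 e)
  have hψ' (k : ℕ) (v : List ℕ →₀ 𝕜) : ψ' k (Finsupp.linearCombination 𝕜 e v) = ψ k v :=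
    LinearMap.extendOfNorm_eq he.denseRange ⟨1, hbound k⟩ v
  have hcommon (k : ℕ) {x : E} (hx : x ∈ closedSpan (𝕜 := 𝕜) e (prefixes ν)) :
      ψ' 0 x = ψ' k x :=
    closedSpan_induction (isClosed_eq (ψ' 0).continuous (ψ' k).continuous)
      (fun v => by rw [hψ', hψ', ← hφ.map_restr_prefixes, ← hφ.map_restr_prefixes]) hx
  refine ⟨_, mem_genLambda_iff.2 ⟨(ψ' 0).comp (Submodule.subtypeL _),
    fun k => (ψ' k).comp (Submodule.subtypeL _), α, hφ.weight, fun k x y => ?_, fun _ => rfl⟩,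
    fun K v => ?_⟩
  · simp only [ContinuousLinearMap.comp_apply, Submodule.subtypeL_apply]
    rw [hcommon k x.2, ← map_add, ambientNorm_apply, ← one_mul ‖(x : E) + y‖]
    exact LinearMap.norm_extendOfNorm_apply_le he.denseRange 1 (hbound k) _
  · rw [hφ.map_nodePart]
    refine congrArg₂ (· + ·) ?_ ((tsum_mul_apply_sum_single _ _ K _).trans ?_) <;>
      simp only [nodeDecomp, ContinuousLinearMap.comp_apply, Submodule.subtypeL_apply,
        IsCoordProj.coe_toClosedSpan, hP v, hQ _ v, hψ']

theorem exists_isGlued_of_mem_genLambda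
    {Φ : GenSum (closedSpan (𝕜 := 𝕜) e (prefixes ν))
      (fun k => closedSpan (𝕜 := 𝕜) e (cone (ν ++ [k]))) → 𝕜}
    (hΦ : Φ ∈ genLambda (𝕜 := 𝕜) fun k =>
      ambientNorm (closedSpan (𝕜 := 𝕜) e (prefixes ν)) (closedSpan e (cone (ν ++ [k]))))
    (K : Finset ℕ) :
    ∃ φ, IsGlued (localNorm 𝕜 e) ν φ ∧ ∀ v,
      φ (nodePart ν K v) = Φ (nodeDecomp he hP hQ K (Finsupp.linearCombination 𝕜 e v)) := by
  obtain ⟨x', y', α, hα, hle, hval⟩ := mem_genLambda_iff.1 hΦ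
  let ξ : (List ℕ →₀ 𝕜) →ₗ[𝕜] 𝕜 :=
    (x'.comp (hP.toClosedSpan he.denseRange)).toLinearMap ∘ₗ Finsupp.linearCombination 𝕜 e
  let ζ (k : ℕ) : (List ℕ →₀ 𝕜) →ₗ[𝕜] 𝕜 :=
    ((y' k).comp ((hQ k).toClosedSpan he.denseRange)).toLinearMap ∘ₗ
      Finsupp.linearCombination 𝕜 e
  have hξ (v : List ℕ →₀ 𝕜) : ξ (restr (prefixes ν) v) = ξ v :=
    congrArg x' (hP.toClosedSpan_linearCombination_restr he.denseRange v)
  have hζ (k : ℕ) (v : List ℕ →₀ 𝕜) : ζ k (restr (cone (ν ++ [k])) v) = ζ k v :=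
    congrArg (y' k) ((hQ k).toClosedSpan_linearCombination_restr he.denseRange v)
  have hξζ_le (k : ℕ) (v : List ℕ →₀ 𝕜) : ‖ξ v + ζ k v‖ ≤ localNorm 𝕜 e (ν ++ [k]) v := by
    rw [localNorm_apply, restr_comparable_concat, map_add, ← hP, ← hQ]
    exact hle k (hP.toClosedSpan he.denseRange _) ((hQ k).toClosedSpan he.denseRange _)
  refine ⟨_, ⟨_, _, isGluing_indicator hα hξ hζ hξζ_le K⟩, fun v => ?_⟩
  calc (ξ + ∑ k ∈ K, (α k : 𝕜) • ζ k) (nodePart ν K v)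
      = ξ v + ∑ k ∈ K, (α k : 𝕜) * ζ k v := by
        rw [LinearMap.add_apply, LinearMap.sum_apply, ← hξ, restr_prefixes_nodePart, hξ]
        refine congrArg _ (Finset.sum_congr rfl fun k hk => ?_)
        rw [LinearMap.smul_apply, ← hζ, restr_cone_nodePart hk, hζ, smul_eq_mul]
    _ = Φ (nodeDecomp he hP hQ K (Finsupp.linearCombination 𝕜 e v)) := by
        rw [hval]
        exact congrArg _ (tsum_mul_apply_sum_single _ _ K _).symm

theorem norm_nodePart_eq_genNorm
    (hN : IsMonotoneSumNorm fun k =>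
      ambientNorm (closedSpan (𝕜 := 𝕜) e (prefixes ν)) (closedSpan e (cone (ν ++ [k]))))
    (hfix : glueNorm (localNorm 𝕜 e) = localNorm 𝕜 e) (K : Finset ℕ) (v : List ℕ →₀ 𝕜) :
    ‖Finsupp.linearCombination 𝕜 e (nodePart ν K v)‖ =
      genNorm (fun k => ambientNorm (closedSpan (𝕜 := 𝕜) e (prefixes ν))
        (closedSpan e (cone (ν ++ [k]))))
        (nodeDecomp he hP hQ K (Finsupp.linearCombination 𝕜 e v)) := by
  rw [← restr_comparable_nodePart, ← localNorm_apply, ← hfix]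
  refine le_antisymm (glueNorm_le he.localNorm_single_le fun φ ⟨α, ψ, hφ⟩ => ?_)
    (genNorm_le fun Φ hΦ => ?_)
  · obtain ⟨Φ, hΦ, hval⟩ := exists_mem_genLambda_of_isGluing he hP hQ hφ
    rw [← hval]
    exact hN.norm_apply_le_genNorm hΦ _
  · obtain ⟨φ, hφ, hval⟩ := exists_isGlued_of_mem_genLambda he hP hQ hΦ K
    rw [← hval]
    exact hφ.norm_apply_le_glueNorm he.localNorm_single_le _

end NodeSum

section Assembly

variable {𝕜 : Type*} [RCLike 𝕜] {E : Type*} [NormedAddCommGroup E] [NormedSpace 𝕜 E]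
  [CompleteSpace E] {e : List ℕ → E}

namespace IsMonotoneTreeSystem

variable (he : IsMonotoneTreeSystem 𝕜 e)
include he

theorem isCoordProj_cone_concat (ν : List ℕ) (k : ℕ) :
    IsCoordProj e (cone (ν ++ [k])) (treeProj 𝕜 e (comparable (ν ++ [k])) -
      treeProj 𝕜 e (prefixes ν)) := by
  have hdiff : comparable (ν ++ [k]) \ prefixes ν = cone (ν ++ [k]) := by
    rw [comparable_concat, Set.union_sdiff_cancel_left
      (disjoint_prefixes_cone_concat ν k).le_bot]
  exact hdiff ▸ (he.isCoordProj_treeProj (isSeqTree_prefixes ν)).sub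
    (he.isCoordProj_treeProj (isSeqTree_comparable _))
    (comparable_concat ν k ▸ Set.subset_union_left)

theorem isMonotoneSumNorm (ν : List ℕ) :
    IsMonotoneSumNorm fun k =>
      ambientNorm (closedSpan (𝕜 := 𝕜) e (prefixes ν)) (closedSpan e (cone (ν ++ [k]))) :=
  isMonotoneSumNorm_ambientNorm fun k x hx y hy => by
    have hP := he.isCoordProj_treeProj (isSeqTree_prefixes ν)
    have hproj : treeProj 𝕜 e (prefixes ν) (x + y) = x := by
      rw [map_add, hP.apply_eq_self hx,
        hP.apply_eq_zero (disjoint_prefixes_cone_concat ν k) hy, add_zero]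
    simpa only [hproj] using he.norm_treeProj_apply_le (isSeqTree_prefixes ν) (x + y)

theorem finiteSumsHaveGenNorm (hfix : glueNorm (localNorm 𝕜 e) = localNorm 𝕜 e) (ν : List ℕ) :
    FiniteSumsHaveGenNorm (closedSpan (𝕜 := 𝕜) e (prefixes ν))
      (fun k => closedSpan e (cone (ν ++ [k]))) := by
  have hN := he.isMonotoneSumNorm ν
  have hP := he.isCoordProj_treeProj (isSeqTree_prefixes ν)
  have hQ := he.isCoordProj_cone_concat ν
  intro K x y
  set P := treeProj 𝕜 e (prefixes ν)
  set Q := fun k => treeProj 𝕜 e (comparable (ν ++ [k])) - P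
  have hnorm (w : E) : ‖P w + ∑ k ∈ K, Q k w‖ = genNorm _ (nodeDecomp he hP hQ K w) :=
    he.denseRange.induction_on w (isClosed_eq (by fun_prop)
      (hN.continuous_genNorm.comp (continuous_nodeDecomp he hP hQ K))) fun v => by
        rw [← norm_nodePart_eq_genNorm he hP hQ hN hfix, nodePart, map_add, map_sum, hP,
          Finset.sum_congr rfl fun k _ => hQ k v]
  have hPw : P ((x : E) + ∑ k ∈ K, (y k : E)) = x := by
    rw [map_add, map_sum, hP.apply_eq_self x.2, Finset.sum_eq_zero fun k _ =>
      hP.apply_eq_zero (disjoint_prefixes_cone_concat ν k) (y k).2, add_zero]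
  have hQw (k : ℕ) (hk : k ∈ K) : Q k ((x : E) + ∑ k ∈ K, (y k : E)) = y k := by
    rw [map_add, map_sum, (hQ k).apply_eq_zero (disjoint_prefixes_cone_concat ν k).symm x.2,
      zero_add, Finset.sum_eq_single_of_mem k hk fun j _ hjk =>
        (hQ k).apply_eq_zero (disjoint_cone_concat ν hjk.symm) (y j).2,
      (hQ k).apply_eq_self (y k).2]
  have hdecomp : nodeDecomp he hP hQ K ((x : E) + ∑ k ∈ K, (y k : E)) =
      (x, ∑ k ∈ K, lp.single 2 k (y k)) :=
    Prod.ext (Subtype.ext hPw) <| Finset.sum_congr rfl fun k hk =>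
      congrArg (lp.single 2 k) (Subtype.ext (hQw k hk))
  rw [← hdecomp, ← hnorm, hPw, Finset.sum_congr rfl hQw]

theorem isGenSum (hfix : glueNorm (localNorm 𝕜 e) = localNorm 𝕜 e) (ν : List ℕ) :
    IsGenSum (𝕜 := 𝕜) (closedSpan e (comparable ν)) (fun k => closedSpan e (comparable (ν ++ [k])))
      (closedSpan e (prefixes ν)) (fun k => closedSpan e (cone (ν ++ [k]))) := by
  have hsup (k : ℕ) : closedSpan (𝕜 := 𝕜) e (comparable (ν ++ [k])) =
      closedSpan e (prefixes ν) ⊔ closedSpan e (cone (ν ++ [k])) := by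
    rw [comparable_concat]
    exact (he.isCoordProj_treeProj (isSeqTree_prefixes ν)).closedSpan_union
      (he.isCoordProj_cone_concat ν k) he.denseRange (disjoint_prefixes_cone_concat ν k)
  simp only [hsup]
  rw [comparable_eq_prefixes_union_iUnion, ← topologicalClosure_closedSpan_sup_iSup]
  exact (he.finiteSumsHaveGenNorm hfix ν).isGenSum (he.isMonotoneSumNorm ν)
    (isClosed_closedSpan _ _) fun k => isClosed_closedSpan _ _

theorem exists_hasSum_norm_add_le {ν : List ℕ} {c : ℝ}
    (hsplit : ∀ v : List ℕ →₀ 𝕜,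
      ‖Finsupp.linearCombination 𝕜 e (restr (prefixes ν) v)‖ +
        c * ‖Finsupp.linearCombination 𝕜 e (restr (comparable ν \ prefixes ν) v)‖ ≤
      localNorm 𝕜 e ν v) {x : E} (hx : x ∈ closedSpan (𝕜 := 𝕜) e (comparable ν)) :
    ∃ y z : E,
      HasSum ((prefixes ν).indicator fun η => treeCoord 𝕜 e η x • e η) y finiteTrees ∧
      HasSum ((comparable ν \ prefixes ν).indicator fun η => treeCoord 𝕜 e η x • e η) z
        finiteTrees ∧
      ‖y‖ + c * ‖z‖ ≤ ‖x‖ := by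
  have hP := he.isCoordProj_treeProj (isSeqTree_prefixes ν)
  have hR := he.isCoordProj_treeProj (isSeqTree_comparable ν)
  have hRP := hP.sub hR (prefixes_subset_comparable ν)
  refine ⟨_, _, he.hasSum_indicator_treeCoord_smul hP x,
    he.hasSum_indicator_treeCoord_smul hRP x, ?_⟩
  refine closedSpan_induction
    (p := fun x => ‖treeProj 𝕜 e (prefixes ν) x‖ +
      c * ‖(treeProj 𝕜 e (comparable ν) - treeProj 𝕜 e (prefixes ν)) x‖ ≤ ‖x‖)
    (isClosed_le (by fun_prop) continuous_norm) (fun v => ?_) hx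
  rw [hP, hRP]
  simpa only [localNorm_apply, restr_restr_self] using hsplit (restr (comparable ν) v)

theorem exists_continuousLinearMap_hasSum_indicator {T : Set (List ℕ)} (hT : IsSeqTree T) :
    ∃ P : E →L[𝕜] E,
      (∀ x, HasSum (T.indicator fun η => treeCoord 𝕜 e η x • e η) (P x) finiteTrees) ∧
        ‖P‖ ≤ 1 :=
  ⟨treeProj 𝕜 e T, he.hasSum_indicator_treeCoord_smul (he.isCoordProj_treeProj hT),
    ContinuousLinearMap.opNorm_le_bound _ zero_le_one fun x => by
      simpa using he.norm_treeProj_apply_le hT x⟩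

end IsMonotoneTreeSystem

end Assembly

section Construction

theorem exists_completion {𝕜 V : Type u} [RCLike 𝕜] [AddCommGroup V] [Module 𝕜 V]
    (p : Seminorm 𝕜 V) :
    ∃ (E : Type u) (_ : NormedAddCommGroup E) (_ : NormedSpace 𝕜 E) (_ : CompleteSpace E)
      (ι : V →ₗ[𝕜] E), DenseRange ι ∧ ∀ v, ‖ι v‖ = p v := by
  let : SeminormedAddCommGroup V := p.toSeminormedAddCommGroup
  let : NormedSpace 𝕜 V := { norm_smul_le := fun c v => (map_smul_eq_mul p c v).le }
  exact ⟨UniformSpace.Completion V, inferInstance, inferInstance, inferInstance,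
    (UniformSpace.Completion.toComplL (𝕜 := 𝕜) (E := V)).toLinearMap,
    UniformSpace.Completion.denseRange_coe, UniformSpace.Completion.norm_coe⟩

namespace IsBranchFamily

variable {𝕜 : Type*} [RCLike 𝕜] {F : Type*} [NormedAddCommGroup F] [NormedSpace 𝕜 F]
  {f : SchauderBasis 𝕜 F} {E : Type*} [NormedAddCommGroup E] [NormedSpace 𝕜 E]
  {e : List ℕ → E} (hN : IsBranchFamily f (localNorm 𝕜 e)) (ν : List ℕ)
include hN

theorem norm_linearCombination_restr_prefixes (v : List ℕ →₀ 𝕜) :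
    ‖Finsupp.linearCombination 𝕜 e (restr (prefixes ν) v)‖ = branchNorm f ν v := by
  rw [← hN.restr_prefixes, localNorm_apply,
    restr_restr_of_superset (prefixes_subset_comparable ν)]

theorem norm_sum_take (r : ℕ → 𝕜) :
    ‖∑ i ∈ Finset.range (ν.length + 1), r i • e (ν.take i)‖ =
      ‖∑ i ∈ Finset.range (ν.length + 1), r i • f i‖ := by
  set v : List ℕ →₀ 𝕜 := ∑ i ∈ Finset.range (ν.length + 1), Finsupp.single (ν.take i) (r i) with hv
  have hv_prefixes : restr (prefixes ν) v = v := by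
    rw [hv, map_sum]
    exact Finset.sum_congr rfl fun i _ => restr_single_of_mem (S := prefixes ν) (ν.take_prefix i) _
  have hlength : lengthMap f v = ∑ i ∈ Finset.range (ν.length + 1), r i • f i := by
    rw [hv, map_sum]
    refine Finset.sum_congr rfl fun i hi => ?_
    rw [lengthMap, Finsupp.linearCombination_single, List.length_take,
      min_eq_left (Finset.mem_range_succ_iff.1 hi)]
  rw [← hlength, ← hv_prefixes, ← branchNorm_apply, ← hN.norm_linearCombination_restr_prefixes,
    hv_prefixes, hv, map_sum]
  simp only [Finsupp.linearCombination_single]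

theorem norm_restr_prefixes_add_le {c : ℝ} (hc : IsSplitting f ν.length c) (v : List ℕ →₀ 𝕜) :
    ‖Finsupp.linearCombination 𝕜 e (restr (prefixes ν) v)‖ +
        c * ‖Finsupp.linearCombination 𝕜 e (restr (comparable ν \ prefixes ν) v)‖ ≤
      localNorm 𝕜 e ν v := by
  have h := hN.split ν ν c hc List.prefix_rfl v
  rwa [localNorm_apply _ (_ - _), map_sub,
    restr_restr_of_superset (prefixes_subset_comparable ν),
    ← restr_diff (prefixes_subset_comparable ν), ← hN.norm_linearCombination_restr_prefixes] at h

end IsBranchFamily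

theorem exists_isMonotoneTreeSystem {𝕜 : Type u} [RCLike 𝕜] {F : Type v} [NormedAddCommGroup F]
    [NormedSpace 𝕜 F] {f : SchauderBasis 𝕜 F} (hf : ∀ n, ‖SchauderBasis.proj f n‖ ≤ 1) :
    ∃ (E : Type u) (_ : NormedAddCommGroup E) (_ : NormedSpace 𝕜 E) (_ : CompleteSpace E)
      (e : List ℕ → E), IsMonotoneTreeSystem 𝕜 e ∧ IsBranchFamily f (localNorm 𝕜 e) ∧
        glueNorm (localNorm 𝕜 e) = localNorm 𝕜 e := by
  have htree := isBranchFamily_treeNorm hf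
  have hfix := glueNorm_treeNorm hf
  obtain ⟨E, _, _, _, ι, hι, hnorm⟩ := exists_completion (treeNorm f [])
  let e (η : List ℕ) : E := ι (Finsupp.single η 1)
  have hlin : Finsupp.linearCombination 𝕜 e = ι := by
    ext η
    simp [e]
  have hlocal : localNorm 𝕜 e = treeNorm f := by
    ext ν v
    rw [localNorm_apply, hlin, hnorm, htree.nil_restr_comparable_of_glueNorm_eq hfix]
  have hbranch : IsBranchFamily f (localNorm 𝕜 e) := hlocal ▸ htree
  have hnorm_e (η : List ℕ) : ‖e η‖ = ‖f η.length‖ := by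
    have hη : η ∈ prefixes η := List.prefix_rfl
    simpa [branchNorm_apply, lengthMap, restr_single_of_mem hη] using
      hbranch.norm_linearCombination_restr_prefixes η (Finsupp.single η 1)
  have he (η : List ℕ) : e η ≠ 0 := by
    rw [← norm_ne_zero_iff, hnorm_e, norm_ne_zero_iff]
    exact f.linearIndependent.ne_zero _
  refine ⟨E, _, _, ‹_›, e, ⟨he, hlin ▸ hι, fun T hT v => ?_⟩, hbranch, hlocal ▸ hfix⟩
  rw [hlin, hnorm, hnorm]
  exact htree.restr_le T hT [] v

end Construction

theorem mainTheorem5_general {𝕜 : Type u} [RCLike 𝕜]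
    {F : Type v} [NormedAddCommGroup F] [NormedSpace 𝕜 F]
    (f : SchauderBasis 𝕜 F) (hf : ∀ n, ‖SchauderBasis.proj f n‖ ≤ 1) :
    ∃ (E : Type u) (_ : NormedAddCommGroup E) (_ : NormedSpace 𝕜 E) (_ : CompleteSpace E)
      (e : GeneralSchauderBasis (List ℕ) 𝕜 E finiteTrees),
      (∀ (ν : List ℕ) (r : ℕ → 𝕜),
        ‖∑ i ∈ Finset.range (ν.length + 1), r i • e (ν.take i)‖ =
          ‖∑ i ∈ Finset.range (ν.length + 1), r i • f i‖) ∧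
      (∀ ν : List ℕ,
        IsGenSum (𝕜 := 𝕜)
          (closedSpan e {η | η <+: ν ∨ ν <+: η})
          (fun k => closedSpan e {η | η <+: ν ++ [k] ∨ ν ++ [k] <+: η})
          (closedSpan e {η | η <+: ν})
          (fun k => closedSpan e {η | ν ++ [k] <+: η})) ∧
      (∀ T : Set (List ℕ), IsSeqTree T →
        ∃ P : E →L[𝕜] E,
          (∀ x, HasSum (T.indicator fun η => e.coord η x • e η) (P x) finiteTrees) ∧ ‖P‖ ≤ 1) ∧
      (∀ (l : ℕ) (c : ℝ), 0 < c →
        (∀ x : F, ‖SchauderBasis.proj f (l + 1) x‖ + c * ‖x - SchauderBasis.proj f (l + 1) x‖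
          ≤ ‖x‖) →
        ∀ ν : List ℕ, ν.length = l →
          ∀ x ∈ closedSpan (𝕜 := 𝕜) e {η | η <+: ν ∨ ν <+: η},
            ∃ y z : E,
              HasSum ({η | η <+: ν}.indicator fun η => e.coord η x • e η) y finiteTrees ∧
              HasSum ({η | ν <+: η ∧ η ≠ ν}.indicator fun η => e.coord η x • e η) z finiteTrees ∧
              ‖y‖ + c * ‖z‖ ≤ ‖x‖) := by
  obtain ⟨E, _, _, _, e, he, hbranch, hfix⟩ := exists_isMonotoneTreeSystem hf
  exact ⟨E, _, _, ‹_›, he.basis, hbranch.norm_sum_take, he.isGenSum hfix,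
    fun _ hT => he.exists_continuousLinearMap_hasSum_indicator hT, by
    rintro _ c hc hsplit ν rfl x hx
    rw [← comparable_diff_prefixes]
    exact he.exists_hasSum_norm_add_le (hbranch.norm_restr_prefixes_add_le ν ⟨hc, hsplit⟩) hx⟩

theorem mainTheorem5 {𝕜 : Type u} [RCLike 𝕜]
    {F : Type v} [NormedAddCommGroup F] [NormedSpace 𝕜 F] [CompleteSpace F]
    (f : SchauderBasis 𝕜 F) (hf : ∀ n, ‖SchauderBasis.proj f n‖ ≤ 1) :
    ∃ (E : Type u) (_ : NormedAddCommGroup E) (_ : NormedSpace 𝕜 E) (_ : CompleteSpace E)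
      (e : GeneralSchauderBasis (List ℕ) 𝕜 E finiteTrees),
      -- (a) finite branches
      (∀ (ν : List ℕ) (r : ℕ → 𝕜),
        ‖∑ i ∈ Finset.range (ν.length + 1), r i • e (ν.take i)‖ =
          ‖∑ i ∈ Finset.range (ν.length + 1), r i • f i‖) ∧
      -- (b) `E_ν = Σ(E_{ν,k})`
      (∀ ν : List ℕ,
        IsGenSum (𝕜 := 𝕜)
          (closedSpan e {η | η <+: ν ∨ ν <+: η})
          (fun k => closedSpan e {η | η <+: ν ++ [k] ∨ ν ++ [k] <+: η})
          (closedSpan e {η | η <+: ν})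
          (fun k => closedSpan e {η | ν ++ [k] <+: η})) ∧
      -- (c) tree projections
      (∀ T : Set (List ℕ), IsSeqTree T →
        ∃ P : E →L[𝕜] E,
          (∀ x, HasSum (T.indicator fun η => e.coord η x • e η) (P x) finiteTrees) ∧ ‖P‖ ≤ 1) ∧
      -- (d) splitting along initial segments
      (∀ (l : ℕ) (c : ℝ), 0 < c →
        (∀ x : F, ‖SchauderBasis.proj f (l + 1) x‖ + c * ‖x - SchauderBasis.proj f (l + 1) x‖
          ≤ ‖x‖) →
        ∀ ν : List ℕ, ν.length = l →
          ∀ x ∈ closedSpan (𝕜 := 𝕜) e {η | η <+: ν ∨ ν <+: η},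
            ∃ y z : E,
              HasSum ({η | η <+: ν}.indicator fun η => e.coord η x • e η) y finiteTrees ∧
              HasSum ({η | ν <+: η ∧ η ≠ ν}.indicator fun η => e.coord η x • e η) z finiteTrees ∧
              ‖y‖ + c * ‖z‖ ≤ ‖x‖) :=
  mainTheorem5_general f hf
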